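/- A parameterized problem is a set $L\subseteq\{0,1\}^*\times\mathbb N$, where the second component of an instance $(x,k)$ is the parameter. An fpt-reduction from $L$ to $L'$ is a map $R:(x,k)\mapsto(x',k')$ such that $(x,k)\in L$ if and only if $R(x,k)\in L'$, $R$ is computable (on a random access machine with addition and subtraction, unit cost) in time $f(k)\cdot(|x|+1)^{c}$ for some computable function $f$ and some constant $c$, and $k'\le g(k)$ for some computable function $g$. The class $\mathrm W[1]$ consists of the parameterized problems that have an fpt-reduction to Weighted 2-CNF-Satisfiability (given a 2-CNF formula and $k$, is there a satisfying assignment with exactly $k$ variables true? parameter $k$). Digraphs are finite, without loops and parallel arcs. A digraph is Euler if its underlying undirected graph is connected and every vertex has in-degree equal to its out-degree. **Theorem.** The problem of deciding, given a digraph $D$ and an integer $k\ge 0$, whether $D$ has $k$ pairwise vertex-disjoint directed cycles, parameterized by $k$, is $\mathrm W[1]$-hard even when restricted to Euler digraphs: every parameterized problem in $\mathrm W[1]$ has an fpt-reduction to it such that every instance $(x,k)$ is mapped to an instance $(H,k')$ in which $H$ is an Euler digraph. -/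

import Mathlib

/-! ## Random access machines with a step count -/

namespace RAM

/-- Structured programs for a random access machine. The machine has registers, named by natural
numbers, and unbounded arrays, named by natural numbers; a program mentions only finitely many of
them. Every register and every array cell holds a natural number. -/
inductive Prog : Type
  /-- do nothing -/
  | skip : Prog
  /-- `reg r := c`, where the constant `c` is part of the program -/
  | const (r c : ℕ) : Prog
  /-- `reg r := reg a + reg b` -/
  | add (r a b : ℕ) : Prog
  /-- `reg r := max (reg a - reg b) 0` -/
  | sub (r a b : ℕ) : Prog
  /-- `reg r := arr A [reg i]` -/
  | load (r A i : ℕ) : Prog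
  /-- `arr A [reg i] := reg r` -/
  | store (A i r : ℕ) : Prog
  /-- first `p`, then `q` -/
  | seq (p q : Prog) : Prog
  /-- if `reg r ≠ 0` then `p` else `q` -/
  | cond (r : ℕ) (p q : Prog) : Prog
  /-- while `reg r ≠ 0` do `p` -/
  | loop (r : ℕ) (p : Prog) : Prog

/-- A memory state. -/
structure State where
  reg : ℕ → ℕ
  arr : ℕ → ℕ → ℕ

/-- The state after `reg r := v`. -/
def State.setReg (s : State) (r v : ℕ) : State :=
  { s with reg := Function.update s.reg r v }

/-- The state after `arr A [i] := v`. -/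
def State.setArr (s : State) (A i v : ℕ) : State :=
  { s with arr := Function.update s.arr A (Function.update (s.arr A) i v) }

/-- `Exec p s t s'`: started in state `s`, the program `p` halts after exactly `t` steps, in
state `s'`. Each elementary instruction and each test of a register counts as one step. -/
inductive Exec : Prog → State → ℕ → State → Prop
  | skip (s : State) : Exec .skip s 1 s
  | const (s : State) (r c : ℕ) : Exec (.const r c) s 1 (s.setReg r c)
  | add (s : State) (r a b : ℕ) : Exec (.add r a b) s 1 (s.setReg r (s.reg a + s.reg b))
  | sub (s : State) (r a b : ℕ) : Exec (.sub r a b) s 1 (s.setReg r (s.reg a - s.reg b))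
  | load (s : State) (r A i : ℕ) : Exec (.load r A i) s 1 (s.setReg r (s.arr A (s.reg i)))
  | store (s : State) (A i r : ℕ) : Exec (.store A i r) s 1 (s.setArr A (s.reg i) (s.reg r))
  | seq {p q : Prog} {s s' s'' : State} {t t' : ℕ} :
      Exec p s t s' → Exec q s' t' s'' → Exec (.seq p q) s (t + t') s''
  | condTrue {r : ℕ} {p q : Prog} {s s' : State} {t : ℕ} :
      s.reg r ≠ 0 → Exec p s t s' → Exec (.cond r p q) s (1 + t) s'
  | condFalse {r : ℕ} {p q : Prog} {s s' : State} {t : ℕ} :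
      s.reg r = 0 → Exec q s t s' → Exec (.cond r p q) s (1 + t) s'
  | loopDone {r : ℕ} {p : Prog} {s : State} :
      s.reg r = 0 → Exec (.loop r p) s 1 s
  | loopStep {r : ℕ} {p : Prog} {s s' s'' : State} {t t' : ℕ} :
      s.reg r ≠ 0 → Exec p s t s' → Exec (.loop r p) s' t' s'' →
      Exec (.loop r p) s (1 + t + t') s''

/-- The content of an array cell that holds a symbol of a bit string, or a blank. -/
def symbol : Option Bool → ℕ
  | none => 0
  | some false => 1
  | some true => 2

/-- The initial state on input `(x, k)`: register `0` holds `k`, array `0` holds the string `x`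
followed by blanks, and everything else is `0`. -/
def input (x : List Bool) (k : ℕ) : State where
  reg r := if r = 0 then k else 0
  arr A i := if A = 0 then symbol x[i]? else 0

/-- The state `s` shows the output `(y, k)`: register `0` holds `k`, and array `0` holds the
string `y` followed by a blank. -/
def IsOutput (s : State) (y : List Bool) (k : ℕ) : Prop :=
  s.reg 0 = k ∧ ∀ i ≤ y.length, s.arr 0 i = symbol y[i]?

end RAM

/-! ## Parameterized problems, fpt-reductions, and the class W[1] -/

namespace ParamComplexity

/-- An instance of a parameterized problem: a bit string, and the parameter. -/
abbrev Instance : Type := List Bool × ℕ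

/-- A parameterized problem is given by the set of its yes-instances. -/
abbrev Problem : Type := Set Instance

/-- The map `R` is computed by a program that on input `(x, k)` halts after at most
`f k * (|x| + 1) ^ c` steps, for a computable function `f` and a constant `c`. -/
def FPTComputable (R : Instance → Instance) : Prop :=
  ∃ (p : RAM.Prog) (f : ℕ → ℕ) (c : ℕ), Computable f ∧
    ∀ (x : List Bool) (k : ℕ), ∃ (t : ℕ) (s : RAM.State),
      RAM.Exec p (RAM.input x k) t s ∧ t ≤ f k * (x.length + 1) ^ c ∧
      RAM.IsOutput s (R (x, k)).1 (R (x, k)).2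

/-- The map `R` is an fpt-reduction from the problem `L` to the problem `L'`. -/
structure IsFPTReduction (R : Instance → Instance) (L L' : Problem) : Prop where
  mem_iff : ∀ w : Instance, w ∈ L ↔ R w ∈ L'
  computable : FPTComputable R
  param_le : ∃ g : ℕ → ℕ, Computable g ∧ ∀ (x : List Bool) (k : ℕ), (R (x, k)).2 ≤ g k

/-- The `m × m` bit matrix `M`, written row by row as a string of length `m * m`. -/
def encodeMatrix {m : ℕ} (M : Fin m → Fin m → Bool) : List Bool :=
  List.ofFn fun t : Fin (m * m) => M (finProdFinEquiv.symm t).1 (finProdFinEquiv.symm t).2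

/-- A literal over the variables `0, …, n - 1`: `(v, 0)` is the variable `v`, and `(v, 1)` is its
negation. -/
abbrev Literal (n : ℕ) : Type := Fin n × Fin 2

/-- A literal is true under an assignment `a`. -/
def Literal.Holds {n : ℕ} (a : Fin n → Bool) (l : Literal n) : Prop :=
  if l.2 = 0 then a l.1 = true else a l.1 = false

/-- A 2-CNF formula over the variables `0, …, n - 1`: a set of clauses `l₁ ∨ l₂`
(where `l₁ = l₂` is allowed, which gives the clauses of size one). -/
abbrev TwoCNF (n : ℕ) : Type := Finset (Literal n × Literal n)

/-- The assignment `a` satisfies the formula `φ`. -/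
def TwoCNF.SatisfiedBy {n : ℕ} (φ : TwoCNF n) (a : Fin n → Bool) : Prop :=
  ∀ c ∈ φ, c.1.Holds a ∨ c.2.Holds a

/-- A 2-CNF formula as a string: the matrix that says for each pair of literals
whether their disjunction is a clause. -/
def TwoCNF.encode {n : ℕ} (φ : TwoCNF n) : List Bool :=
  encodeMatrix fun i j : Fin (n * 2) => decide ((finProdFinEquiv.symm i, finProdFinEquiv.symm j) ∈ φ)

/-- Weighted 2-CNF-Satisfiability: does the formula have a satisfying assignment under which
exactly `k` variables are true? The parameter is `k`. -/
def weightedTwoCNFSat : Problem :=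
  {w | ∃ (n : ℕ) (φ : TwoCNF n), w.1 = φ.encode ∧
    ∃ a : Fin n → Bool, φ.SatisfiedBy a ∧ (Finset.univ.filter fun v => a v = true).card = w.2}

/-- The class W[1]: the parameterized problems that have an fpt-reduction to
Weighted 2-CNF-Satisfiability. -/
def W1 : Set Problem :=
  {L | ∃ R : Instance → Instance, IsFPTReduction R L weightedTwoCNFSat}

/-- The problem `P` is W[1]-hard even when it is restricted to the instances in `I`: every problem
in W[1] has an fpt-reduction to `P` all of whose values lie in `I`. -/
def IsW1HardOn (P : Problem) (I : Set Instance) : Prop :=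
  ∀ L ∈ W1, ∃ R : Instance → Instance, IsFPTReduction R L P ∧ ∀ w : Instance, R w ∈ I

end ParamComplexity

/-! ## Digraphs -/

namespace Digraph

/-- A directed cycle of `D`: a cyclic sequence of one or more distinct vertices, in which there is
an arc from each vertex to the next one. -/
structure IsDirectedCycle {V : Type*} (D : Digraph V) (c : Cycle V) : Prop where
  ne_nil : c ≠ Cycle.nil
  nodup : c.Nodup
  chain : c.Chain D.Adj

/-- `D` has `k` pairwise vertex-disjoint directed cycles. -/
def HasDisjointCycles {V : Type*} (D : Digraph V) (k : ℕ) : Prop :=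
  ∃ C : Fin k → Cycle V, (∀ i, D.IsDirectedCycle (C i)) ∧
    ∀ i j, i ≠ j → ∀ v, v ∈ C i → v ∉ C j

/-- `D` has no loops. (It cannot have parallel arcs.) -/
def Loopless {V : Type*} (D : Digraph V) : Prop :=
  ∀ v, ¬ D.Adj v v

/-- A digraph is Euler if it is connected (as an undirected graph) and the in-degree of each
vertex equals its out-degree. -/
structure IsEuler {V : Type*} (D : Digraph V) : Prop where
  connected : D.toSimpleGraphInclusive.Connected
  balanced : ∀ v : V, {u | D.Adj u v}.ncard = {u | D.Adj v u}.ncard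

open Classical in
/-- A digraph as a string: its adjacency matrix. -/
noncomputable def encode {n : ℕ} (D : Digraph (Fin n)) : List Bool :=
  ParamComplexity.encodeMatrix fun u v => decide (D.Adj u v)

/-- The vertex-disjoint directed cycles problem: does the given digraph have `k` vertex-disjoint
directed cycles? The parameter is `k`. -/
def vertexDisjointCycles : ParamComplexity.Problem :=
  {w | ∃ (n : ℕ) (D : Digraph (Fin n)), D.Loopless ∧ w.1 = D.encode ∧ D.HasDisjointCycles w.2}

/-- The instances whose digraph is an Euler digraph. -/
def eulerInstances : Set ParamComplexity.Instance :=
  {w | ∃ (n : ℕ) (D : Digraph (Fin n)), D.Loopless ∧ D.IsEuler ∧ w.1 = D.encode}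

end Digraph

/-!
Let `φ` be a 2-CNF formula. An assignment of weight `k` is given by its `k + 1` gaps, the pairs of
consecutive true variables (with sentinels at both ends). Whether a literal is false can be seen
from a single gap, so whether the assignment satisfies `φ` can be tested on pairs of gaps; one more,
trailing gap ensures that there is a pair even for `k = 0`. This makes `φ` a binary constraint
satisfaction problem with `K = k + 2` variables, whose values are the possible gaps.

Such a problem becomes a disjoint cycles problem on a grid with `K` rows of two levels. Every
directed cycle meets one of `K * K` roots, so `K * K` disjoint cycles contain one root each. The
cycle of the root `(i, i)` runs through the whole row `i` except for one block of positions, and so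
selects a value of the `i`-th variable. The cycle of the root `(i, j)`, where `i < j`, has to change
levels in both of the rows `i` and `j`. It can do so only in the blocks that are left free there,
and only if the two selected values are compatible.

To make the digraph Euler, every arc is completed to a closed walk through a new vertex, the hub, in
such a way that every cycle through a new vertex contains the hub. Hence at most one of a family of
disjoint cycles is new, and there is always room for one such cycle: the extension has `k + 1`
disjoint cycles if and only if the digraph has `k`.

The adjacency matrix of the result is described by a formula with bounded quantifiers over the
input. Such formulas compile to machine programs that run in polynomial time.
-/

namespace ParamComplexity

open Digraph

/-! ## Directed cycles -/

section DirectedCycle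

variable {V W : Type*} {D : Digraph V} {D' : Digraph W} {c : Cycle V} {k : ℕ}

theorem exists_eq_coe_cons_of_mem {v : V} (hv : v ∈ c) : ∃ l : List V, c = ↑(v :: l) := by
  obtain ⟨l, rfl⟩ := Quot.exists_rep c
  obtain ⟨s, t, rfl⟩ := List.append_of_mem (show v ∈ l from hv)
  exact ⟨t ++ s, Cycle.coe_eq_coe.2 List.isRotated_append⟩

theorem exists_mem_of_ne_nil (hc : c ≠ Cycle.nil) : ∃ v, v ∈ c := by
  obtain ⟨l, rfl⟩ := Quot.exists_rep c
  exact List.exists_mem_of_ne_nil l fun h => hc (congrArg _ h)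

theorem chain_of_forall_mem_imp {r s : V → V → Prop} (hc : c.Chain r)
    (hrs : ∀ a ∈ c, ∀ b ∈ c, r a b → s a b) : c.Chain s := by
  rcases eq_or_ne c Cycle.nil with rfl | hne
  · exact Cycle.Chain.nil s
  obtain ⟨v, hv⟩ := exists_mem_of_ne_nil hne
  obtain ⟨l, rfl⟩ := exists_eq_coe_cons_of_mem hv
  rw [Cycle.chain_coe_cons] at hc ⊢
  have hmem : ∀ x ∈ v :: (l ++ [v]), x ∈ (↑(v :: l) : Cycle V) := by
    simp only [List.mem_cons, List.mem_append, Cycle.mem_coe_iff]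
    tauto
  exact hc.imp_of_mem_imp fun x y hx hy => hrs x (hmem x hx) y (hmem y hy)

theorem exists_succ_mem (hc : D.IsDirectedCycle c) {v : V} (hv : v ∈ c) :
    ∃ w ∈ c, D.Adj v w := by
  have hchain := hc.chain
  obtain ⟨l, rfl⟩ := exists_eq_coe_cons_of_mem hv
  rw [Cycle.chain_coe_cons] at hchain
  rcases l with - | ⟨w, l⟩
  · exact ⟨v, hv, (List.isChain_cons_cons.1 hchain).1⟩
  · exact ⟨w, by simp, (List.isChain_cons_cons.1 hchain).1⟩

theorem exists_pred_mem (hc : D.IsDirectedCycle c) {v : V} (hv : v ∈ c) :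
    ∃ w ∈ c, D.Adj w v := by
  have hchain := hc.chain
  obtain ⟨l, rfl⟩ := exists_eq_coe_cons_of_mem hv
  rw [Cycle.chain_coe_cons] at hchain
  rcases List.eq_nil_or_concat l with rfl | ⟨l, w, rfl⟩
  · exact ⟨v, hv, (List.isChain_cons_cons.1 hchain).1⟩
  · have hsplit : List.IsChain D.Adj ((v :: l) ++ [w, v]) := by simpa using hchain
    exact ⟨w, by simp, (List.isChain_cons_cons.1 (List.isChain_append.1 hsplit).2.1).1⟩

theorem isDirectedCycle_map (hc : D.IsDirectedCycle c) {f : V → W}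
    (hadj : ∀ u ∈ c, ∀ v ∈ c, D.Adj u v → D'.Adj (f u) (f v))
    (hinj : ∀ u ∈ c, ∀ v ∈ c, f u = f v → u = v) : D'.IsDirectedCycle (c.map f) where
  ne_nil := (Cycle.map_eq_nil f c).not.2 hc.ne_nil
  nodup := by
    have hnodup := hc.nodup
    obtain ⟨l, rfl⟩ := Quot.exists_rep c
    exact List.Nodup.map_on (fun u hu v hv => hinj u hu v hv) hnodup
  chain := (Cycle.chain_map f).2 (chain_of_forall_mem_imp hc.chain hadj)

theorem hasDisjointCycles_of_map {C : Fin k → Cycle V} (hC : ∀ i, D.IsDirectedCycle (C i))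
    (hdisj : ∀ i j, i ≠ j → ∀ v, v ∈ C i → v ∉ C j) (f : V → W)
    (hadj : ∀ i, ∀ u ∈ C i, ∀ v ∈ C i, D.Adj u v → D'.Adj (f u) (f v))
    (hinj : ∀ i j, ∀ u ∈ C i, ∀ v ∈ C j, f u = f v → u = v) : D'.HasDisjointCycles k := by
  refine ⟨fun i => (C i).map f, fun i => isDirectedCycle_map (hC i) (hadj i) (hinj i i),
    fun i j hij v hvi hvj => ?_⟩
  obtain ⟨a, ha, rfl⟩ := Cycle.mem_map.1 hvi
  obtain ⟨b, hb, hab⟩ := Cycle.mem_map.1 hvj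
  exact hdisj i j hij a ha (hinj i j a ha b hb hab.symm ▸ hb)

theorem hasDisjointCycles_map (h : D.HasDisjointCycles k) (f : V → W)
    (hadj : ∀ u v, D.Adj u v → D'.Adj (f u) (f v))
    (hinj : Set.InjOn f {v | ∃ w, D.Adj v w}) : D'.HasDisjointCycles k := by
  obtain ⟨C, hC, hdisj⟩ := h
  refine hasDisjointCycles_of_map hC hdisj f (fun _ u _ v _ => hadj u v) fun i j u hu v hv => ?_
  obtain ⟨u', -, hu'⟩ := exists_succ_mem (hC i) hu
  obtain ⟨v', -, hv'⟩ := exists_succ_mem (hC j) hv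
  exact hinj ⟨u', hu'⟩ ⟨v', hv'⟩

end DirectedCycle

/-! ## Numbering the vertices of a digraph -/

section Relabel

variable {V : Type*} {D : Digraph V} {code : V → ℕ} {N k : ℕ}

/-- The digraph on `0, …, N - 1` whose arcs are the arcs of `D`, each vertex being replaced by its
number. Arcs with an endpoint whose number is not less than `N` are dropped. -/
def relabel (D : Digraph V) (code : V → ℕ) (N : ℕ) : Digraph (Fin N) :=
  ⟨fun p q => ∃ u v, D.Adj u v ∧ code u = p ∧ code v = q⟩

theorem relabel_loopless (hD : D.Loopless)
    (hinj : ∀ u v, D.Adj u v → code u = code v → u = v) : (relabel D code N).Loopless := by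
  rintro p ⟨u, v, huv, hu, hv⟩
  obtain rfl := hinj u v huv (hu.trans hv.symm)
  exact hD u huv

theorem hasDisjointCycles_relabel_iff {S : Set V} (hS : S.Nonempty)
    (hadj : ∀ u v, D.Adj u v → u ∈ S ∧ v ∈ S) (hinj : Set.InjOn code S)
    (hlt : ∀ v ∈ S, code v < N) :
    (relabel D code N).HasDisjointCycles k ↔ D.HasDisjointCycles k := by
  obtain ⟨v₀, hv₀⟩ := hS
  have : Nonempty V := ⟨v₀⟩
  have : NeZero N := ⟨(Nat.zero_le _).trans_lt (hlt v₀ hv₀) |>.ne'⟩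
  have hdecode : ∀ v ∈ S, Function.invFunOn code S (code v) = v := fun v hv =>
    hinj.leftInvOn_invFunOn hv
  have hnumber : ∀ v ∈ S, (Fin.ofNat N (code v) : ℕ) = code v := fun v hv =>
    Nat.mod_eq_of_lt (hlt v hv)
  constructor <;> intro h
  · refine hasDisjointCycles_map h (fun p => Function.invFunOn code S p) ?_ ?_
    · rintro p q ⟨u, v, huv, hu, hv⟩
      rw [← hu, ← hv, hdecode u (hadj u v huv).1, hdecode v (hadj u v huv).2]
      exact huv
    · rintro p ⟨-, u, v, huv, hu, -⟩ q ⟨-, u', v', huv', hu', -⟩ hpq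
      simp only [← hu, ← hu', hdecode u (hadj u v huv).1, hdecode u' (hadj u' v' huv').1] at hpq
      exact Fin.ext (hu.symm.trans ((congrArg code hpq).trans hu'))
  · refine hasDisjointCycles_map h (fun v => Fin.ofNat N (code v)) ?_ ?_
    · intro u v huv
      exact ⟨u, v, huv, (hnumber u (hadj u v huv).1).symm, (hnumber v (hadj u v huv).2).symm⟩
    · rintro u ⟨v, huv⟩ u' ⟨v', huv'⟩ heq
      refine hinj (hadj u v huv).1 (hadj u' v' huv').1 ?_
      rw [← hnumber u (hadj u v huv).1, ← hnumber u' (hadj u' v' huv').1]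
      exact congrArg Fin.val heq

theorem isEuler_of_equiv {W : Type*} {D' : Digraph W} (e : W ≃ V)
    (he : ∀ x y, D'.Adj x y ↔ D.Adj (e x) (e y)) (hD : D.IsEuler) : D'.IsEuler where
  connected := by
    let iso : D'.toSimpleGraphInclusive ≃g D.toSimpleGraphInclusive :=
      ⟨e, fun {a b} => by simp [toSimpleGraphInclusive, he]⟩
    exact iso.connected_iff.2 hD.connected
  balanced v := by
    have hin : {u | D'.Adj u v} = e ⁻¹' {u | D.Adj u (e v)} := by ext; simp [he]
    have hout : {u | D'.Adj v u} = e ⁻¹' {u | D.Adj (e v) u} := by ext; simp [he]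
    rw [hin, hout, Set.ncard_preimage_of_injective_subset_range e.injective (by simp),
      Set.ncard_preimage_of_injective_subset_range e.injective (by simp), hD.balanced]

theorem relabel_isEuler (e : V ≃ Fin N) (hD : D.IsEuler) :
    (relabel D (fun v => e v) N).IsEuler := by
  refine isEuler_of_equiv e.symm (fun p q => ⟨?_, fun h => ⟨_, _, h, by simp, by simp⟩⟩) hD
  rintro ⟨u, v, huv, hu, hv⟩
  obtain rfl := Fin.ext hu
  obtain rfl := Fin.ext hv
  simpa using huv

end Relabel

/-! ## Making a digraph Euler -/

/-- The vertices of the Eulerian extension of a digraph on `V`: the vertices of the digraph, for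
each pair of vertices one vertex that leads to a hub and one that is reached from the hub, and
the hub itself. -/
inductive EulerVertex (V : Type*)
  | base (v : V)
  | toHub (u v : V)
  | fromHub (u v : V)
  | hub

section Eulerize

open EulerVertex

variable {V : Type*} {D : Digraph V} {k : ℕ}

/-- The arcs of the Eulerian extension of `D`. An arc `u → v` of `D` is completed to a closed walk
through the hub. For the other pairs the auxiliary vertices, which are present for every pair so
that the vertices can be numbered independently of `D`, lie on a closed walk of length two. The
vertices of `D` are joined to the hub in both directions for connectivity. -/
inductive EulerAdj (D : Digraph V) : EulerVertex V → EulerVertex V → Prop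
  | arc {u v : V} : D.Adj u v → EulerAdj D (base u) (base v)
  | leave {u v : V} : D.Adj u v → EulerAdj D (base v) (toHub u v)
  | arrive (u v : V) : EulerAdj D (toHub u v) hub
  | back {u v : V} : ¬D.Adj u v → EulerAdj D hub (toHub u v)
  | depart (u v : V) : EulerAdj D hub (fromHub u v)
  | enter {u v : V} : D.Adj u v → EulerAdj D (fromHub u v) (base u)
  | goBack {u v : V} : ¬D.Adj u v → EulerAdj D (fromHub u v) hub
  | ascend (v : V) : EulerAdj D (base v) hub
  | descend (v : V) : EulerAdj D hub (base v)

/-- The Eulerian extension of a digraph. -/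
def eulerize (D : Digraph V) : Digraph (EulerVertex V) := ⟨EulerAdj D⟩

theorem eulerize_loopless (hD : D.Loopless) : (eulerize D).Loopless := by
  rintro (v | ⟨u, v⟩ | ⟨u, v⟩ | _) h
  · cases h with | arc h => exact hD _ h
  all_goals cases h

theorem toHub_isDirectedCycle {u v : V} (h : ¬D.Adj u v) :
    (eulerize D).IsDirectedCycle ([hub, toHub u v] : List (EulerVertex V)) where
  ne_nil := by simp
  nodup := by simp
  chain := by
    simp only [Cycle.chain_coe_cons, List.cons_append, List.nil_append, List.isChain_cons_cons,
      List.isChain_singleton, and_true]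
    exact ⟨.back h, .arrive u v⟩

theorem hasDisjointCycles_eulerize [Nonempty V] (hD : D.Loopless) (h : D.HasDisjointCycles k) :
    (eulerize D).HasDisjointCycles (k + 1) := by
  obtain ⟨C, hC, hdisj⟩ := h
  obtain ⟨v₀⟩ := ‹Nonempty V›
  let extra : Cycle (EulerVertex V) := ([hub, toHub v₀ v₀] : List (EulerVertex V))
  have base_notMem_extra : ∀ v, base v ∉ extra := by simp [extra]
  refine ⟨Fin.cons extra fun i => (C i).map base, ?_, ?_⟩
  · refine Fin.cases (toHub_isDirectedCycle (hD v₀)) fun i => ?_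
    exact isDirectedCycle_map (hC i) (fun u _ v _ h => .arc h) fun u _ v _ h => base.inj h
  · refine Fin.cases (Fin.cases (by simp) fun j _ v hv hvj => ?_) fun i =>
      Fin.cases (fun _ v hvi hv => ?_) fun j hij v hvi hvj => ?_
    · obtain ⟨a, -, rfl⟩ := Cycle.mem_map.1 hvj
      exact base_notMem_extra a hv
    · obtain ⟨a, -, rfl⟩ := Cycle.mem_map.1 hvi
      exact base_notMem_extra a hv
    · obtain ⟨a, ha, rfl⟩ := Cycle.mem_map.1 hvi
      obtain ⟨b, hb, hba⟩ := Cycle.mem_map.1 hvj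
      obtain rfl := base.inj hba
      exact hdisj i j (fun h => hij (congrArg _ h)) b ha hb

theorem exists_eq_base_of_mem {c : Cycle (EulerVertex V)} (hc : (eulerize D).IsDirectedCycle c)
    (hhub : hub ∉ c) {x : EulerVertex V} (hx : x ∈ c) : ∃ v, x = base v := by
  obtain ⟨y, hy, hxy⟩ := exists_succ_mem hc hx
  obtain ⟨z, hz, hzx⟩ := exists_pred_mem hc hx
  rcases x with v | ⟨u, v⟩ | ⟨u, v⟩ | _
  · exact ⟨v, rfl⟩
  · cases hxy with | arrive => exact (hhub hy).elim
  · cases hzx with | depart => exact (hhub hz).elim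
  · exact (hhub hx).elim

theorem hasDisjointCycles_of_eulerize [Nonempty V]
    (h : (eulerize D).HasDisjointCycles (k + 1)) : D.HasDisjointCycles k := by
  obtain ⟨C, hC, hdisj⟩ := h
  obtain ⟨v₀⟩ := ‹Nonempty V›
  obtain ⟨i₀, hi₀⟩ : ∃ i₀, ∀ i, hub ∈ C i → i = i₀ := by
    by_cases h : ∃ i, hub ∈ C i
    · obtain ⟨i₀, hi₀⟩ := h
      exact ⟨i₀, fun i hi => by_contra fun hne => hdisj i i₀ hne _ hi hi₀⟩
    · exact ⟨0, fun i hi => (h ⟨i, hi⟩).elim⟩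
  have hbase : ∀ i, ∀ x ∈ C (i₀.succAbove i), ∃ v, x = base v := fun i x =>
    exists_eq_base_of_mem (hC _) fun h => Fin.succAbove_ne i₀ i (hi₀ _ h)
  let toVertex : EulerVertex V → V := fun | base v => v | _ => v₀
  refine hasDisjointCycles_of_map (fun i => hC (i₀.succAbove i))
    (fun i j hij => hdisj _ _ fun h => hij (Fin.succAbove_right_injective h)) toVertex ?_ ?_
  · intro i x hx y hy hxy
    obtain ⟨u, rfl⟩ := hbase i x hx
    obtain ⟨v, rfl⟩ := hbase i y hy
    cases hxy with | arc h => exact h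
  · intro i j x hx y hy hxy
    obtain ⟨u, rfl⟩ := hbase i x hx
    obtain ⟨v, rfl⟩ := hbase j y hy
    exact congrArg base hxy

theorem hasDisjointCycles_eulerize_iff [Nonempty V] (hD : D.Loopless) :
    (eulerize D).HasDisjointCycles (k + 1) ↔ D.HasDisjointCycles k :=
  ⟨hasDisjointCycles_of_eulerize, hasDisjointCycles_eulerize hD⟩

theorem eulerize_connected : (eulerize D).toSimpleGraphInclusive.Connected := by
  have reachable_hub : ∀ x, x ≠ hub → (eulerize D).Adj x hub ∨ (eulerize D).Adj hub x →
      (eulerize D).toSimpleGraphInclusive.Reachable hub x := fun x hne h =>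
    SimpleGraph.Adj.reachable (SimpleGraph.fromRel_adj _ _ _ |>.2 ⟨hne.symm, h.symm⟩)
  rw [SimpleGraph.connected_iff_exists_forall_reachable]
  refine ⟨hub, ?_⟩
  rintro (v | ⟨u, v⟩ | ⟨u, v⟩ | _)
  · exact reachable_hub _ nofun (.inl (.ascend v))
  · exact reachable_hub _ nofun (.inl (.arrive u v))
  · exact reachable_hub _ nofun (.inr (.depart u v))
  · exact .rfl

theorem ncard_eq_of_mapsTo_of_leftInvOn {α : Type*} {S T : Set α} {f g : α → α}
    (hf : Set.MapsTo f S T) (hg : Set.MapsTo g T S) (hgf : Set.LeftInvOn g f S)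
    (hfg : Set.LeftInvOn f g T) : S.ncard = T.ncard :=
  Set.ncard_congr' ((Set.InvOn.bijOn ⟨hgf, hfg⟩ hf hg).equiv f)

theorem eulerize_balanced_base (v : V) :
    {x | (eulerize D).Adj x (base v)}.ncard = {x | (eulerize D).Adj (base v) x}.ncard := by
  refine ncard_eq_of_mapsTo_of_leftInvOn
    (f := fun | base u => toHub u v | fromHub _ w => base w | x => x)
    (g := fun | toHub u _ => base u | base w => fromHub v w | x => x) ?_ ?_ ?_ ?_
  · intro x hx
    cases hx with
    | arc h => exact .leave h
    | enter h => exact .arc h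
    | descend => exact .ascend v
  · intro x hx
    cases hx with
    | arc h => exact .enter h
    | leave h => exact .arc h
    | ascend => exact .descend v
  · intro x hx
    cases hx <;> rfl
  · intro x hx
    cases hx <;> rfl

theorem eulerize_balanced_toHub (u v : V) :
    {x | (eulerize D).Adj x (toHub u v)}.ncard = {x | (eulerize D).Adj (toHub u v) x}.ncard := by
  have hout : {x | (eulerize D).Adj (toHub u v) x} = {hub} :=
    Set.eq_singleton_iff_unique_mem.2 ⟨.arrive u v, fun _ => fun | .arrive _ _ => rfl⟩
  have hin : ∃ y, {x | (eulerize D).Adj x (toHub u v)} = {y} := by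
    by_cases h : D.Adj u v
    · exact ⟨base v, Set.eq_singleton_iff_unique_mem.2 ⟨.leave h, fun _ => fun
        | .leave _ => rfl
        | .back h' => (h' h).elim⟩⟩
    · exact ⟨hub, Set.eq_singleton_iff_unique_mem.2 ⟨.back h, fun _ => fun
        | .leave h' => (h h').elim
        | .back _ => rfl⟩⟩
  obtain ⟨y, hin⟩ := hin
  rw [hin, hout, Set.ncard_singleton, Set.ncard_singleton]

theorem eulerize_balanced_fromHub (u v : V) :
    {x | (eulerize D).Adj x (fromHub u v)}.ncard =
      {x | (eulerize D).Adj (fromHub u v) x}.ncard := by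
  have hin : {x | (eulerize D).Adj x (fromHub u v)} = {hub} :=
    Set.eq_singleton_iff_unique_mem.2 ⟨.depart u v, fun _ => fun | .depart _ _ => rfl⟩
  have hout : ∃ y, {x | (eulerize D).Adj (fromHub u v) x} = {y} := by
    by_cases h : D.Adj u v
    · exact ⟨base u, Set.eq_singleton_iff_unique_mem.2 ⟨.enter h, fun _ => fun
        | .enter _ => rfl
        | .goBack h' => (h' h).elim⟩⟩
    · exact ⟨hub, Set.eq_singleton_iff_unique_mem.2 ⟨.goBack h, fun _ => fun
        | .enter h' => (h h').elim
        | .goBack _ => rfl⟩⟩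
  obtain ⟨y, hout⟩ := hout
  rw [hin, hout, Set.ncard_singleton, Set.ncard_singleton]

theorem eulerize_balanced_hub :
    {x | (eulerize D).Adj x hub}.ncard = {x | (eulerize D).Adj hub x}.ncard := by
  let swap : EulerVertex V → EulerVertex V :=
    fun | toHub u v => fromHub u v | fromHub u v => toHub u v | x => x
  have swap_swap : ∀ x, swap (swap x) = x := by rintro (_ | _ | _ | _) <;> rfl
  refine ncard_eq_of_mapsTo_of_leftInvOn (f := swap) (g := swap) ?_ ?_ (fun x _ => swap_swap x)
    fun x _ => swap_swap x
  · intro x hx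
    cases hx with
    | arrive u v => exact .depart u v
    | goBack h => exact .back h
    | ascend v => exact .descend v
  · intro x hx
    cases hx with
    | depart u v => exact .arrive u v
    | back h => exact .goBack h
    | descend v => exact .ascend v

theorem eulerize_isEuler : (eulerize D).IsEuler where
  connected := eulerize_connected
  balanced
    | base v => eulerize_balanced_base v
    | toHub u v => eulerize_balanced_toHub u v
    | fromHub u v => eulerize_balanced_fromHub u v
    | hub => eulerize_balanced_hub

end Eulerize

/-! ## Families of disjoint cycles -/

section Family

variable {V ι : Type*} [Fintype ι] {D : Digraph V} {c : Cycle V}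

theorem hasDisjointCycles_card_iff : D.HasDisjointCycles (Fintype.card ι) ↔
    ∃ C : ι → Cycle V, (∀ i, D.IsDirectedCycle (C i)) ∧ ∀ i j v, v ∈ C i → v ∈ C j → i = j := by
  let e := Fintype.equivFin ι
  constructor
  · rintro ⟨C, hC, hdisj⟩
    exact ⟨fun i => C (e i), fun i => hC (e i), fun i j v hi hj =>
      e.injective (by_contra fun hne => hdisj _ _ hne v hi hj)⟩
  · rintro ⟨C, hC, hdisj⟩
    exact ⟨fun a => C (e.symm a), fun a => hC (e.symm a), fun a b hab v ha hb =>
      hab (e.symm.injective (hdisj _ _ v ha hb))⟩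

/-- Disjoint cycles have distinct roots, so if there are as many cycles as roots, then every root
lies on one of them. -/
theorem exists_rooted_cycles (root : ι → V)
    (hroot : ∀ c, D.IsDirectedCycle c → ∃ i, root i ∈ c)
    (h : D.HasDisjointCycles (Fintype.card ι)) :
    ∃ C : ι → Cycle V, (∀ i, D.IsDirectedCycle (C i)) ∧ (∀ i, root i ∈ C i) ∧
      ∀ i j v, v ∈ C i → v ∈ C j → i = j := by
  obtain ⟨C, hC, hdisj⟩ := hasDisjointCycles_card_iff.1 h
  choose r hr using fun i => hroot (C i) (hC i)
  have r_injective : r.Injective := fun i j hij => hdisj i j _ (hr i) (hij ▸ hr j)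
  let e := Equiv.ofBijective r (Finite.injective_iff_bijective.1 r_injective)
  refine ⟨fun i => C (e.symm i), fun i => hC _, fun i => ?_, fun i j v hi hj =>
    e.symm.injective (hdisj _ _ v hi hj)⟩
  simpa only [e, Equiv.ofBijective_apply_symm_apply] using hr (e.symm i)

theorem exists_adj_leaving (hc : D.IsDirectedCycle c) (P : V → Prop) {u v : V} (hu : u ∈ c)
    (hv : v ∈ c) (hPu : P u) (hPv : ¬P v) : ∃ a ∈ c, ∃ b ∈ c, D.Adj a b ∧ P a ∧ ¬P b := by
  by_contra! hno
  have hchain : c.Chain fun a b => P a → P b :=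
    chain_of_forall_mem_imp hc.chain fun a ha b hb hab => hno a ha b hb hab
  have : IsTrans V fun a b => P a → P b := ⟨fun _ _ _ hab hbc ha => hbc (hab ha)⟩
  exact hPv (Cycle.chain_iff_pairwise.1 hchain u hu v hv hPu)

theorem exists_not_lt_rank (hc : D.IsDirectedCycle c) (rank : V → ℕ) :
    ∃ a ∈ c, ∃ b ∈ c, D.Adj a b ∧ ¬rank a < rank b := by
  by_contra! hno
  have hchain : c.Chain fun a b => rank a < rank b :=
    chain_of_forall_mem_imp hc.chain fun a ha b hb hab => hno a ha b hb hab
  exact hc.ne_nil ((Cycle.map_eq_nil rank c).1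
    (Cycle.Chain.eq_nil_of_irrefl ((Cycle.chain_map rank).2 hchain)))

end Family

/-! ## Binary constraint satisfaction as a disjoint cycles problem -/

/-- `x` solves the binary constraint satisfaction problem with variables `0, …, K - 1`, which all
have the domain `0, …, M - 1`, and with the constraint `compat i u j v` for `i < j`. -/
structure IsSolution (K M : ℕ) (compat : ℕ → ℕ → ℕ → ℕ → Prop) (x : ℕ → ℕ) : Prop where
  lt : ∀ i < K, x i < M
  compat : ∀ i j, i < j → j < K → compat i (x i) j (x j)

/-- The vertices of the digraph of a constraint satisfaction problem with `K` variables and `M`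
values. The vertex `root i j` identifies the selector cycle of the variable `i` if `i = j` and the
verifier cycle of the pair `i < j`; if `j < i`, it lies on a cycle with `mate i j` only, so that
there are `K * K` roots altogether. The vertex `node i t l` is at position `t ≤ M * K + 1` on level
`l < 2` of the row of the variable `i`. -/
inductive GridVertex
  | root (i j : ℕ)
  | mate (i j : ℕ)
  | node (i t l : ℕ)

/-- The position `t` lies in the block of `K` positions that belongs to the value `v`. -/
def InBlock (K v t : ℕ) : Prop := v * K < t ∧ t ≤ v * K + K

open GridVertex

/-- The arcs of the digraph of a constraint satisfaction problem. A selector cycle runs through its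
row, first on level `0` and then on level `1`, and skips the block of the value that it selects; a
verifier cycle passes from level `0` to level `1` in a block of each of its two rows. -/
inductive GridAdj (K M : ℕ) (compat : ℕ → ℕ → ℕ → ℕ → Prop) : GridVertex → GridVertex → Prop
  | start {i : ℕ} : i < K → GridAdj K M compat (root i i) (node i 0 0)
  | finish {i : ℕ} : i < K → GridAdj K M compat (node i (M * K + 1) 1) (root i i)
  | step {i t l : ℕ} : i < K → t ≤ M * K → l < 2 →
      GridAdj K M compat (node i t l) (node i (t + 1) l)
  | skip {i v : ℕ} : i < K → v < M →
      GridAdj K M compat (node i (v * K) 0) (node i (v * K + K + 1) 1)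
  | down {i t : ℕ} : i < K → t ≤ M * K + 1 → GridAdj K M compat (node i t 0) (node i t 1)
  | enter {i j u : ℕ} : i < j → j < K → u < M →
      GridAdj K M compat (root i j) (node i (u * K + j + 1) 0)
  | cross {i j u v : ℕ} : i < j → j < K → u < M → v < M → compat i u j v →
      GridAdj K M compat (node i (u * K + j + 1) 1) (node j (v * K + i + 1) 0)
  | exit {i j v : ℕ} : i < j → j < K → v < M →
      GridAdj K M compat (node j (v * K + i + 1) 1) (root i j)
  | toMate {i j : ℕ} : j < i → i < K → GridAdj K M compat (root i j) (mate i j)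
  | ofMate {i j : ℕ} : j < i → i < K → GridAdj K M compat (mate i j) (root i j)

/-- The digraph of a constraint satisfaction problem. -/
def grid (K M : ℕ) (compat : ℕ → ℕ → ℕ → ℕ → Prop) : Digraph GridVertex := ⟨GridAdj K M compat⟩

section Grid

variable {K M : ℕ} {compat : ℕ → ℕ → ℕ → ℕ → Prop}

theorem grid_loopless : (grid K M compat).Loopless := by
  have hne : ∀ p q, GridAdj K M compat p q → p ≠ q := by
    rintro p q (_ | _) <;> grind
  exact fun v h => hne v v h rfl

theorem mul_add_le_mul_of_lt {u M K : ℕ} (hu : u < M) : u * K + K ≤ M * K := by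
  simpa only [Nat.succ_mul] using Nat.mul_le_mul_right K hu

theorem inBlock_mul_add {j : ℕ} (hj : j < K) (u : ℕ) : InBlock K u (u * K + j + 1) := by
  unfold InBlock
  omega

theorem InBlock.unique {u v t : ℕ} (hu : InBlock K u t) (hv : InBlock K v t) : u = v := by
  by_contra hne
  rcases Nat.lt_or_gt_of_ne hne with hlt | hlt
  · exact (hu.2.trans (mul_add_le_mul_of_lt hlt)).not_gt hv.1
  · exact (hv.2.trans (mul_add_le_mul_of_lt hlt)).not_gt hu.1

/-- The vertex carries coordinates that occur in the digraph. -/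
def IsProper (K M : ℕ) : GridVertex → Prop
  | root i j => i < K ∧ j < K
  | mate i j => i < K ∧ j < K
  | node i t l => i < K ∧ t ≤ M * K + 1 ∧ l < 2

theorem GridAdj.isProper {p q : GridVertex} (h : GridAdj K M compat p q) :
    IsProper K M p ∧ IsProper K M q := by
  have hblock : ∀ u < M, u * K + K ≤ M * K := fun u hu => mul_add_le_mul_of_lt hu
  cases h <;> grind [IsProper]

/-! ### The solution of a family of disjoint cycles -/

/-- The position of a vertex in a linear order in which all arcs between nodes go up. -/
def nodeRank (K M : ℕ) : GridVertex → ℕ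
  | node i t l => (i * (M * K + 2) + t) * 2 + l
  | _ => 0

theorem GridAdj.nodeRank_lt {i j t t' l l' : ℕ}
    (h : GridAdj K M compat (node i t l) (node j t' l')) :
    nodeRank K M (node i t l) < nodeRank K M (node j t' l') := by
  have hproper := h.isProper
  simp only [IsProper] at hproper
  simp only [nodeRank]
  cases h with
  | step => omega
  | skip => omega
  | down => omega
  | cross hij =>
    have hrow := mul_add_le_mul_of_lt (K := M * K + 2) hij
    omega

theorem exists_root_mem {c : Cycle GridVertex} (hc : (grid K M compat).IsDirectedCycle c) :
    ∃ a : Fin K × Fin K, root a.1 a.2 ∈ c := by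
  suffices ∃ i j, root i j ∈ c by
    obtain ⟨i, j, hij⟩ := this
    obtain ⟨q, -, hq⟩ := exists_succ_mem hc hij
    obtain ⟨hi, hj⟩ := (GridAdj.isProper hq).1
    exact ⟨(⟨i, hi⟩, ⟨j, hj⟩), hij⟩
  by_contra! hroot
  have hmate : ∀ i j, mate i j ∉ c := by
    intro i j hij
    obtain ⟨q, hq, hadj⟩ := exists_succ_mem hc hij
    cases hadj with | ofMate => exact hroot _ _ hq
  obtain ⟨p, hp, q, hq, hpq, hnot⟩ := exists_not_lt_rank hc (nodeRank K M)
  rcases p with ⟨i, j⟩ | ⟨i, j⟩ | _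
  · exact hroot i j hp
  · exact hmate i j hp
  rcases q with ⟨i, j⟩ | ⟨i, j⟩ | _
  · exact hroot i j hq
  · exact hmate i j hq
  exact hnot (GridAdj.nodeRank_lt hpq)

/-- A directed cycle of the digraph of a constraint satisfaction problem that contains the root
`(i, j)`, where `i ≤ j`, and no other: the selector cycle of `i` if `i = j` and the verifier cycle
of `(i, j)` otherwise. -/
structure IsRootCycle (K M : ℕ) (compat : ℕ → ℕ → ℕ → ℕ → Prop) (i j : ℕ)
    (c : Cycle GridVertex) : Prop where
  isDirectedCycle : (grid K M compat).IsDirectedCycle c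
  mem : root i j ∈ c
  le : i ≤ j
  lt : j < K
  unique : ∀ {i' j'}, root i' j' ∈ c → i' = i ∧ j' = j

namespace IsRootCycle

variable {c : Cycle GridVertex} {i j r t l : ℕ}

theorem exists_succ (h : IsRootCycle K M compat i j c) {p : GridVertex} (hp : p ∈ c) :
    ∃ q ∈ c, GridAdj K M compat p q := exists_succ_mem h.isDirectedCycle hp

theorem exists_pred (h : IsRootCycle K M compat i j c) {p : GridVertex} (hp : p ∈ c) :
    ∃ q ∈ c, GridAdj K M compat q p := exists_pred_mem h.isDirectedCycle hp

theorem isProper (h : IsRootCycle K M compat i j c) {p : GridVertex} (hp : p ∈ c) :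
    IsProper K M p := by
  obtain ⟨q, -, hpq⟩ := h.exists_succ hp
  exact hpq.isProper.1

theorem exists_leaving_row (h : IsRootCycle K M compat i j c) (P : ℕ → ℕ → ℕ → Prop)
    (hmem : node r t l ∈ c) (hP : P r t l) :
    ∃ r t l q, node r t l ∈ c ∧ q ∈ c ∧ GridAdj K M compat (node r t l) q ∧ P r t l ∧
      ∀ r' t' l', q = node r' t' l' → ¬P r' t' l' := by
  obtain ⟨-, ha, q, hq, hadj, ⟨r, t, l, rfl, hPa⟩, hPq⟩ :=
    exists_adj_leaving h.isDirectedCycle (fun p => ∃ r t l, p = node r t l ∧ P r t l) hmem h.mem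
      ⟨r, t, l, rfl, hP⟩ (by simp)
  exact ⟨r, t, l, q, ha, hq, hadj, hPa, fun r' t' l' hq' hP' => hPq ⟨r', t', l', hq', hP'⟩⟩

theorem exists_entering_row (h : IsRootCycle K M compat i j c) (P : ℕ → ℕ → ℕ → Prop)
    (hmem : node r t l ∈ c) (hP : P r t l) :
    ∃ p r t l, p ∈ c ∧ node r t l ∈ c ∧ GridAdj K M compat p (node r t l) ∧ P r t l ∧
      ∀ r' t' l', p = node r' t' l' → ¬P r' t' l' := by
  obtain ⟨p, hp, b, hb, hadj, hPp, hPb⟩ :=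
    exists_adj_leaving h.isDirectedCycle (fun p => ¬∃ r t l, p = node r t l ∧ P r t l) h.mem hmem
      (by simp) (not_not.2 ⟨r, t, l, rfl, hP⟩)
  obtain ⟨r', t', l', rfl, hP'⟩ := not_not.1 hPb
  exact ⟨p, r', t', l', hp, hb, hadj, hP', fun r t l hp' hP => hPp ⟨r, t, l, hp', hP⟩⟩

theorem row_le (h : IsRootCycle K M compat i j c) (hmem : node r t l ∈ c) : r ≤ j := by
  by_contra! hr
  obtain ⟨r, t, l, q, -, hq, hadj, hr, hout⟩ :=
    h.exists_leaving_row (fun r _ _ => j < r) hmem hr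
  have := h.le
  cases hadj with
  | finish => have := h.unique hq; omega
  | step => exact hout _ _ _ rfl hr
  | skip => exact hout _ _ _ rfl hr
  | down => exact hout _ _ _ rfl hr
  | cross hrr' => exact hout _ _ _ rfl (hr.trans hrr')
  | exit => have := h.unique hq; omega

theorem le_row (h : IsRootCycle K M compat i j c) (hmem : node r t l ∈ c) : i ≤ r := by
  by_contra! hr
  obtain ⟨p, r, t, l, hp, -, hadj, hr, hin⟩ :=
    h.exists_entering_row (fun r _ _ => r < i) hmem hr
  have := h.le
  cases hadj with
  | start => have := h.unique hp; omega
  | step => exact hin _ _ _ rfl hr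
  | skip => exact hin _ _ _ rfl hr
  | down => exact hin _ _ _ rfl hr
  | enter => have := h.unique hp; omega
  | cross hrr' => exact hin _ _ _ rfl (hrr'.trans hr)

theorem mem_upper (h : IsRootCycle K M compat i i c) (hmem : node i t 1 ∈ c) {t' : ℕ}
    (htt' : t ≤ t') (ht' : t' ≤ M * K + 1) : node i t' 1 ∈ c := by
  induction t', htt' using Nat.le_induction with
  | base => exact hmem
  | succ t' _ ih =>
    obtain ⟨q, hq, hadj⟩ := h.exists_succ (ih (by omega))
    cases hadj with
    | finish => omega
    | step => exact hq
    | cross hij => have := h.row_le hq; omega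
    | exit hij => have := h.unique hq; omega

theorem mem_lower (h : IsRootCycle K M compat i i c) (hmem : node i t 0 ∈ c) {t' : ℕ}
    (ht' : t' ≤ t) : node i t' 0 ∈ c := by
  induction ht' using Nat.decreasingInduction with
  | self => exact hmem
  | of_succ t' _ ih =>
    obtain ⟨p, hp, hadj⟩ := h.exists_pred ih
    cases hadj with
    | step => exact hp
    | enter hij => have := h.unique hp; omega
    | cross hij => have := h.le_row hp; omega

theorem exists_mem_of_not_inBlock (h : IsRootCycle K M compat i i c) (hM : 0 < M) :
    ∃ v < M, ∀ t ≤ M * K + 1, ¬InBlock K v t → node i t 0 ∈ c ∨ node i t 1 ∈ c := by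
  have hstart : node i 0 0 ∈ c := by
    obtain ⟨q, hq, hadj⟩ := h.exists_succ h.mem
    cases hadj with
    | start => exact hq
    | enter hij => omega
    | toMate hij => omega
  obtain ⟨r, t, l, q, hmem, hq, hadj, ⟨hr, hl⟩, hout⟩ :=
    h.exists_leaving_row (fun r _ l => r = i ∧ l = 0) hstart ⟨rfl, rfl⟩
  subst r l
  cases hadj with
  | step => exact (hout _ _ _ rfl ⟨rfl, rfl⟩).elim
  | @skip _ v hi hv =>
    refine ⟨v, hv, fun t ht hblock => ?_⟩
    rcases Nat.lt_or_ge (v * K) t with hlt | hge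
    · exact .inr (h.mem_upper hq (by unfold InBlock at hblock; omega) ht)
    · exact .inl (h.mem_lower hmem hge)
  | down =>
    refine ⟨0, hM, fun t' ht' _ => ?_⟩
    rcases Nat.lt_or_ge t t' with hlt | hge
    · exact .inr (h.mem_upper hq hlt.le ht')
    · exact .inl (h.mem_lower hmem hge)

section Disjoint

variable {s : Cycle GridVertex}

/-- Once a cycle disjoint from a selector cycle is on level `0` below the upper part of the
selector cycle, it cannot leave this level. -/
theorem notMem_lower_of_mem_upper (h : IsRootCycle K M compat i j c)
    (hs : IsRootCycle K M compat r r s) (hdisj : ∀ p ∈ c, p ∉ s) (hmem : node r t 1 ∈ s) :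
    node r t 0 ∉ c := by
  intro hp
  obtain ⟨r', t', l', q, hmem', hq, hadj, ⟨hr, htt', hl⟩, hout⟩ :=
    h.exists_leaving_row (fun r' t' l => r' = r ∧ t ≤ t' ∧ l = 0) hp ⟨rfl, le_rfl, rfl⟩
  subst r' l'
  cases hadj with
  | step => exact hout _ _ _ rfl ⟨rfl, by omega, rfl⟩
  | skip _ hv =>
    have := mul_add_le_mul_of_lt (K := K) hv
    exact hdisj _ hq (hs.mem_upper hmem (by omega) (by omega))
  | down _ ht' => exact hdisj _ hq (hs.mem_upper hmem htt' ht')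

theorem notMem_upper_of_mem_lower (h : IsRootCycle K M compat i j c)
    (hs : IsRootCycle K M compat r r s) (hdisj : ∀ p ∈ c, p ∉ s) (hmem : node r t 0 ∈ s) :
    node r t 1 ∉ c := by
  intro hp
  obtain ⟨p, r', t', l', hp', -, hadj, ⟨hr, htt', hl⟩, hin⟩ :=
    h.exists_entering_row (fun r' t' l => r' = r ∧ t' ≤ t ∧ l = 1) hp ⟨rfl, le_rfl, rfl⟩
  subst r' l'
  cases hadj with
  | step => exact hin _ _ _ rfl ⟨rfl, by omega, rfl⟩
  | skip => exact hdisj _ hp' (hs.mem_lower hmem (by omega))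
  | down => exact hdisj _ hp' (hs.mem_lower hmem htt')

theorem inBlock_of_disjoint (h : IsRootCycle K M compat i j c)
    (hs : IsRootCycle K M compat r r s) (hdisj : ∀ p ∈ c, p ∉ s) {v : ℕ}
    (hv : ∀ t ≤ M * K + 1, ¬InBlock K v t → node r t 0 ∈ s ∨ node r t 1 ∈ s)
    (hmem : node r t l ∈ c) : InBlock K v t := by
  by_contra hblock
  obtain ⟨-, ht, hl⟩ := h.isProper hmem
  rcases hv t ht hblock with hlow | hup <;> interval_cases l
  · exact hdisj _ hmem hlow
  · exact h.notMem_upper_of_mem_lower hs hdisj hlow hmem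
  · exact h.notMem_lower_of_mem_upper hs hdisj hup hmem
  · exact hdisj _ hmem hup

end Disjoint

theorem compat_of_forall_inBlock (h : IsRootCycle K M compat i j c) (hij : i < j) {x : ℕ → ℕ}
    (hx : ∀ r t l, node r t l ∈ c → InBlock K (x r) t) : compat i (x i) j (x j) := by
  have hj := h.lt
  obtain ⟨u, henter⟩ : ∃ u, node i (u * K + j + 1) 0 ∈ c := by
    obtain ⟨q, hq, hadj⟩ := h.exists_succ h.mem
    cases hadj with
    | start => exact (lt_irrefl i hij).elim
    | @enter _ _ u => exact ⟨u, hq⟩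
    | toMate hji => omega
  obtain ⟨r, t, l, q, hmem, hq, hadj, ⟨hr, hut⟩, hout⟩ :=
    h.exists_leaving_row (fun r t _ => r = i ∧ u * K + j + 1 ≤ t) henter ⟨rfl, le_rfl⟩
  subst r
  cases hadj with
  | finish => have := h.unique hq; omega
  | step => exact (hout _ _ _ rfl ⟨rfl, by omega⟩).elim
  | skip => exact (hout _ _ _ rfl ⟨rfl, by omega⟩).elim
  | down => exact (hout _ _ _ rfl ⟨rfl, hut⟩).elim
  | @cross _ j' u' v hij' hj' _ _ hcompat =>
    have hu : u = x i := (inBlock_mul_add hj u).unique (hx _ _ _ henter)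
    have hu' : u' = x i := (inBlock_mul_add hj' u').unique (hx _ _ _ hmem)
    have hv : v = x j' := (inBlock_mul_add (hij.trans hj) v).unique (hx _ _ _ hq)
    have hjj' : j' = j := by
      have := h.row_le hq
      subst u u'
      omega
    subst j' u' v
    exact hcompat
  | exit => have := h.unique hq; omega

end IsRootCycle

theorem exists_isSolution_of_hasDisjointCycles (hM : 0 < M)
    (h : (grid K M compat).HasDisjointCycles (K * K)) : ∃ x, IsSolution K M compat x := by
  have hcard : Fintype.card (Fin K × Fin K) = K * K := by simp
  obtain ⟨C, hC, hroot, hdisj⟩ := exists_rooted_cycles (fun a : Fin K × Fin K => root a.1 a.2)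
    (fun _ => exists_root_mem) (hcard ▸ h)
  have hrootCycle : ∀ i j : Fin K, i ≤ j → IsRootCycle K M compat i j (C (i, j)) := by
    refine fun i j hij => ⟨hC _, hroot (i, j), hij, j.2, fun {i' j'} hmem => ?_⟩
    obtain ⟨q, -, hadj⟩ := exists_succ_mem (hC (i, j)) hmem
    obtain ⟨hi', hj'⟩ := (GridAdj.isProper hadj).1
    have heq := hdisj (⟨i', hi'⟩, ⟨j', hj'⟩) (i, j) _ (hroot _) hmem
    simp only [Prod.mk.injEq, Fin.ext_iff] at heq
    exact heq
  choose x hxM hx using fun i => (hrootCycle i i le_rfl).exists_mem_of_not_inBlock hM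
  let y : ℕ → ℕ := fun i => if hi : i < K then x ⟨i, hi⟩ else 0
  have hy : ∀ i : Fin K, y i = x i := fun i => dif_pos i.2
  refine ⟨y, fun i hi => hy ⟨i, hi⟩ ▸ hxM _, fun i j hij hj => ?_⟩
  have hverifier := hrootCycle ⟨i, hij.trans hj⟩ ⟨j, hj⟩ hij.le
  refine hverifier.compat_of_forall_inBlock hij fun r t l hmem => ?_
  obtain ⟨hr, -⟩ := hverifier.isProper hmem
  rw [hy ⟨r, hr⟩]
  refine hverifier.inBlock_of_disjoint (hrootCycle ⟨r, hr⟩ ⟨r, hr⟩ le_rfl) ?_ (hx ⟨r, hr⟩) hmem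
  intro p hp hp'
  have heq := hdisj _ _ p hp hp'
  simp only [Prod.mk.injEq, Fin.mk.injEq] at heq
  omega

/-! ### The family of disjoint cycles of a solution -/

/-- The vertices of the selector cycle of the variable `i` for the value `v`, in their order. -/
def selector (K i v : ℕ) : ℕ → GridVertex
  | 0 => root i i
  | t + 1 => if t ≤ v * K then node i t 0 else node i (t + K) 1

theorem selector_isDirectedCycle {i v : ℕ} (hi : i < K) (hv : v < M) :
    (grid K M compat).IsDirectedCycle
      ((List.range ((M - 1) * K + 2).succ).map (selector K i v) : List GridVertex) := by
  obtain ⟨m, rfl⟩ : ∃ m, M = m + 1 := ⟨M - 1, by omega⟩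
  have hvm : v * K ≤ m * K := Nat.mul_le_mul_right K (by omega)
  have hmK : (m + 1) * K = m * K + K := Nat.succ_mul m K
  refine ⟨by simp, Cycle.nodup_coe_iff.2 ?_, ?_⟩
  · refine List.nodup_range.map ?_
    rintro (- | a) (- | b) hab <;> simp only [selector] at hab <;> grind
  · rw [← Cycle.map_coe, Cycle.chain_map, Cycle.chain_range_succ, Nat.add_sub_cancel]
    constructor
    · simp only [selector]
      rw [if_neg (by omega), show m * K + 1 + K = (m + 1) * K + 1 by omega]
      exact .finish hi
    · rintro (- | t) ht
      · exact .start hi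
      simp only [selector]
      rcases Nat.lt_trichotomy t (v * K) with hlt | rfl | hgt
      · rw [if_pos hlt.le, if_pos (Nat.succ_le_of_lt hlt)]
        exact .step hi (by omega) (by omega)
      · rw [if_pos le_rfl, if_neg (by omega), Nat.add_right_comm]
        exact .skip hi hv
      · rw [if_neg (by omega), if_neg (by omega), Nat.add_right_comm]
        exact .step hi (by omega) (by omega)

theorem verifier_isDirectedCycle {i j u v : ℕ} (hij : i < j) (hj : j < K) (hu : u < M)
    (hv : v < M) (hcompat : compat i u j v) :
    (grid K M compat).IsDirectedCycle ([root i j, node i (u * K + j + 1) 0,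
      node i (u * K + j + 1) 1, node j (v * K + i + 1) 0, node j (v * K + i + 1) 1] :
      List GridVertex) where
  ne_nil := by simp
  nodup := by simp [hij.ne]
  chain := by
    have hu' := mul_add_le_mul_of_lt (K := K) hu
    have hv' := mul_add_le_mul_of_lt (K := K) hv
    simp only [Cycle.chain_coe_cons, List.cons_append, List.nil_append, List.isChain_cons_cons,
      List.isChain_singleton, and_true]
    exact ⟨.enter hij hj hu, .down (hij.trans hj) (by omega), .cross hij hj hu hv hcompat,
      .down hj (by omega), .exit hij hj hv⟩

theorem mate_isDirectedCycle {i j : ℕ} (hji : j < i) (hi : i < K) :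
    (grid K M compat).IsDirectedCycle ([root i j, mate i j] : List GridVertex) where
  ne_nil := by simp
  nodup := by simp
  chain := by
    simp only [Cycle.chain_coe_cons, List.cons_append, List.nil_append, List.isChain_cons_cons,
      List.isChain_singleton, and_true]
    exact ⟨.toMate hji hi, .ofMate hji hi⟩

/-- The cycle with the root `(i, j)` in the family of disjoint cycles of the solution `x`. -/
def solutionCycle (K M : ℕ) (x : ℕ → ℕ) (i j : ℕ) : Cycle GridVertex :=
  if i = j then ((List.range ((M - 1) * K + 2).succ).map (selector K i (x i)) : List GridVertex)
  else if i < j then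
    ([root i j, node i (x i * K + j + 1) 0, node i (x i * K + j + 1) 1,
      node j (x j * K + i + 1) 0, node j (x j * K + i + 1) 1] : List GridVertex)
  else ([root i j, mate i j] : List GridVertex)

theorem solutionCycle_isDirectedCycle {x : ℕ → ℕ} (hx : IsSolution K M compat x) {i j : ℕ}
    (hi : i < K) (hj : j < K) : (grid K M compat).IsDirectedCycle (solutionCycle K M x i j) := by
  unfold solutionCycle
  split_ifs with heq hlt
  · exact selector_isDirectedCycle hi (hx.lt i hi)
  · exact verifier_isDirectedCycle hlt hj (hx.lt i hi) (hx.lt j hj) (hx.compat i j hlt hj)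
  · exact mate_isDirectedCycle (by omega) hi

open Classical in
/-- The root of the only cycle in the family of disjoint cycles of the solution `x` that a vertex
can lie on. -/
noncomputable def owner (K : ℕ) (x : ℕ → ℕ) : GridVertex → ℕ × ℕ
  | root i j => (i, j)
  | mate i j => (i, j)
  | node r t _ =>
    if InBlock K (x r) t then (min r (t - 1 - x r * K), max r (t - 1 - x r * K)) else (r, r)

theorem owner_selector (x : ℕ → ℕ) (i t : ℕ) : owner K x (selector K i (x i) t) = (i, i) := by
  rcases t with - | t
  · rfl
  simp only [selector]
  split_ifs <;> exact if_neg (by unfold InBlock; omega)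

theorem owner_node_mul_add (x : ℕ → ℕ) {j : ℕ} (hj : j < K) (r l : ℕ) :
    owner K x (node r (x r * K + j + 1) l) = (min r j, max r j) := by
  have hsub : x r * K + j + 1 - 1 - x r * K = j := by omega
  simp only [owner, if_pos (inBlock_mul_add hj (x r)), hsub]

theorem owner_eq_of_mem {x : ℕ → ℕ} {i j : ℕ} (hi : i < K) (hj : j < K) {p : GridVertex}
    (hp : p ∈ solutionCycle K M x i j) : owner K x p = (i, j) := by
  unfold solutionCycle at hp
  split_ifs at hp with heq hlt <;> rw [Cycle.mem_coe_iff] at hp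
  · obtain ⟨t, -, rfl⟩ := List.mem_map.1 hp
    rw [owner_selector, heq]
  · simp only [List.mem_cons, List.not_mem_nil, or_false] at hp
    rcases hp with rfl | rfl | rfl | rfl | rfl
    · rfl
    · rw [owner_node_mul_add x hj, min_eq_left hlt.le, max_eq_right hlt.le]
    · rw [owner_node_mul_add x hj, min_eq_left hlt.le, max_eq_right hlt.le]
    · rw [owner_node_mul_add x hi, min_eq_right hlt.le, max_eq_left hlt.le]
    · rw [owner_node_mul_add x hi, min_eq_right hlt.le, max_eq_left hlt.le]
  · simp only [List.mem_cons, List.not_mem_nil, or_false] at hp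
    rcases hp with rfl | rfl <;> rfl

theorem IsSolution.hasDisjointCycles {x : ℕ → ℕ} (hx : IsSolution K M compat x) :
    (grid K M compat).HasDisjointCycles (K * K) := by
  have hcard : Fintype.card (Fin K × Fin K) = K * K := by simp
  refine hcard ▸ hasDisjointCycles_card_iff.2 ⟨fun a : Fin K × Fin K => solutionCycle K M x a.1 a.2,
    fun a => solutionCycle_isDirectedCycle hx a.1.2 a.2.2, fun a b p ha hb => ?_⟩
  have howner := (owner_eq_of_mem a.1.2 a.2.2 ha).symm.trans (owner_eq_of_mem b.1.2 b.2.2 hb)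
  exact Prod.ext (Fin.ext (congrArg Prod.fst howner)) (Fin.ext (congrArg Prod.snd howner))

theorem hasDisjointCycles_grid_iff (hM : 0 < M) :
    (grid K M compat).HasDisjointCycles (K * K) ↔ ∃ x, IsSolution K M compat x :=
  ⟨exists_isSolution_of_hasDisjointCycles hM, fun ⟨_, hx⟩ => hx.hasDisjointCycles⟩

end Grid

/-! ## Weighted 2-CNF satisfiability as a constraint satisfaction problem -/

/-- The literal with variable `w` and sign `s` is false under every assignment in which `a < b` are
consecutive true variables, where the variables are counted from `1`. -/
def FalsifiedBy (a b w s : ℕ) : Prop :=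
  (s = 0 ∧ a < w + 1 ∧ w + 1 < b) ∨ (s = 1 ∧ w + 1 = a)

/-- The constraint between the `i`-th and the `j`-th pair of consecutive true variables of an
assignment of weight `k` to `n` variables. The true variables are counted from `1` and padded by
`0`, `n + 1`, `n + 2`, which gives `k + 2` pairs; the pair `(a, b)` is encoded as `a * (n + 3) + b`.
The set `cl` holds the positions of the clauses in the matrix of `TwoCNF.encode`. -/
def GapCompat (n k : ℕ) (cl : ℕ → Prop) (i u j v : ℕ) : Prop :=
  ∃ a < n + 3, ∃ b < n + 3, ∃ c < n + 3, ∃ d < n + 3,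
    u = a * (n + 3) + b ∧ v = c * (n + 3) + d ∧ a < b ∧ c < d ∧ (i = 0 → a = 0) ∧
    (j = k + 1 → c = n + 1) ∧ (j = i + 1 → b = c) ∧
    ∀ w < n, ∀ s < 2, ∀ w' < n, ∀ s' < 2, cl ((w * 2 + s) * (n * 2) + (w' * 2 + s')) →
      ¬ ((FalsifiedBy a b w s ∨ FalsifiedBy c d w s) ∧
        (FalsifiedBy a b w' s' ∨ FalsifiedBy c d w' s'))

/-- The assignment `a` satisfies the clauses at the positions in `cl`. -/
def Respects {n : ℕ} (cl : ℕ → Prop) (a : Fin n → Bool) : Prop :=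
  ∀ l l' : Literal n,
    cl ((l.1 * 2 + l.2) * (n * 2) + (l'.1 * 2 + l'.2)) → l.Holds a ∨ l'.Holds a

/-- The values `s 0 < s 1 < ⋯ < s (k + 2)` are the true variables of `a`, counted from `1` and
padded by `0`, `n + 1`, `n + 2`. -/
structure IsMarking {n : ℕ} (a : Fin n → Bool) (k : ℕ) (s : ℕ → ℕ) : Prop where
  strictMonoOn : StrictMonoOn s (Set.Iic (k + 2))
  apply_zero : s 0 = 0
  apply_penultimate : s (k + 1) = n + 1
  apply_last : s (k + 2) = n + 2
  eq_true_iff : ∀ w : Fin n, a w = true ↔ ∃ i < k + 2, s i = w + 1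

section Gaps

variable {n k : ℕ} {cl : ℕ → Prop} {a : Fin n → Bool} {s : ℕ → ℕ}

theorem mul_add_div_of_lt {a b m : ℕ} (hb : b < m) : (a * m + b) / m = a := by
  rw [Nat.mul_comm, Nat.mul_add_div (by omega), Nat.div_eq_of_lt hb, Nat.add_zero]

theorem mul_add_mod_of_lt {a b m : ℕ} (hb : b < m) : (a * m + b) % m = b := by
  rw [Nat.mul_comm, Nat.mul_add_mod, Nat.mod_eq_of_lt hb]

theorem mul_add_lt_mul {a b m l : ℕ} (ha : a < l) (hb : b < m) : a * m + b < l * m :=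
  calc a * m + b < (a + 1) * m := by rw [Nat.succ_mul]; omega
    _ ≤ l * m := Nat.mul_le_mul_right m ha

namespace IsMarking

theorem lt_iff_lt (hs : IsMarking a k s) {i j : ℕ} (hi : i ≤ k + 2) (hj : j ≤ k + 2) :
    s i < s j ↔ i < j :=
  hs.strictMonoOn.lt_iff_lt hi hj

theorem apply_lt (hs : IsMarking a k s) {i : ℕ} (hi : i ≤ k + 2) : s i < n + 3 := by
  have := hs.strictMonoOn.monotoneOn hi (Set.mem_Iic.2 le_rfl) hi
  rw [hs.apply_last] at this
  omega

theorem card_eq (hs : IsMarking a k s) : (Finset.univ.filter fun v => a v = true).card = k := by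
  have himage : ((Finset.univ.filter fun v => a v = true).image fun w : Fin n => (w : ℕ) + 1) =
      (Finset.Ioo 0 (k + 1)).image s := by
    ext m
    simp only [Finset.mem_image, Finset.mem_filter, Finset.mem_univ, true_and, Finset.mem_Ioo,
      hs.eq_true_iff]
    constructor
    · rintro ⟨w, ⟨i, hi, hw⟩, rfl⟩
      have h0 := hs.lt_iff_lt (i := 0) (j := i) (by omega) (by omega)
      have h1 := hs.lt_iff_lt (i := i) (j := k + 1) (by omega) (by omega)
      rw [hs.apply_zero] at h0
      rw [hs.apply_penultimate] at h1
      exact ⟨i, by omega, hw⟩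
    · rintro ⟨i, hi, rfl⟩
      have h0 := (hs.lt_iff_lt (i := 0) (j := i) (by omega) (by omega)).2 (by omega)
      have h1 := (hs.lt_iff_lt (i := i) (j := k + 1) (by omega) (by omega)).2 (by omega)
      rw [hs.apply_zero] at h0
      rw [hs.apply_penultimate] at h1
      exact ⟨⟨s i - 1, by omega⟩, ⟨i, by omega, by simp only; omega⟩, by simp only; omega⟩
  have hcard := congrArg Finset.card himage
  rw [Finset.card_image_of_injective _ fun v w h => Fin.ext (Nat.succ_injective h),
    Finset.card_image_of_injOn (hs.strictMonoOn.injOn.mono fun i hi => ?_)] at hcard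
  · simpa using hcard
  · have := Finset.mem_Ioo.1 (Finset.mem_coe.1 hi)
    exact Set.mem_Iic.2 (by omega)

theorem exists_gap_iff (hs : IsMarking a k s) (w : Fin n) :
    (∃ i < k + 2, s i < w + 1 ∧ w + 1 < s (i + 1)) ↔ ¬ a w = true := by
  rw [hs.eq_true_iff]
  constructor
  · rintro ⟨i, hi, hlt, hgt⟩ ⟨j, hj, hw⟩
    rw [← hw, hs.lt_iff_lt (by omega) (by omega)] at hlt hgt
    omega
  · intro hw
    push Not at hw
    have hex : ∃ i, (w : ℕ) + 1 < s (i + 1) := ⟨k, by rw [hs.apply_penultimate]; omega⟩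
    have hle : Nat.find hex ≤ k := Nat.find_min' hex (by rw [hs.apply_penultimate]; omega)
    refine ⟨Nat.find hex, by omega, ?_, Nat.find_spec hex⟩
    rcases hfind : Nat.find hex with _ | i
    · rw [hs.apply_zero]
      omega
    · have := Nat.find_min hex (m := i) (by omega)
      have := hw (i + 1) (by omega)
      omega

theorem exists_falsifiedBy_iff (hs : IsMarking a k s) (l : Literal n) :
    (∃ i < k + 2, FalsifiedBy (s i) (s (i + 1)) l.1 l.2) ↔ ¬ l.Holds a := by
  obtain ⟨w, e⟩ := l
  fin_cases e
  · simpa [FalsifiedBy, Literal.Holds] using hs.exists_gap_iff w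
  · simpa [FalsifiedBy, Literal.Holds, eq_comm (a := (w : ℕ) + 1)] using (hs.eq_true_iff w).symm

end IsMarking

open Classical in
theorem exists_isMarking (ha : (Finset.univ.filter fun v => a v = true).card = k) :
    ∃ s, IsMarking a k s := by
  let p : ℕ → Prop := fun m => m = 0 ∨ n < m ∨ ∃ w : Fin n, m = w + 1 ∧ a w = true
  have hp : {m | p m}.Infinite := (Set.Ioi_infinite n).mono fun m hm => .inr (.inl hm)
  have hfilter : (Finset.range (n + 1)).filter p =
      insert 0 ((Finset.univ.filter fun v => a v = true).image fun w : Fin n => (w : ℕ) + 1) := by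
    ext m
    simp only [p, Finset.mem_filter, Finset.mem_range, Finset.mem_insert, Finset.mem_image,
      Finset.mem_univ, true_and]
    grind
  have hcount : Nat.count p (n + 1) = k + 1 := by
    rw [Nat.count_eq_card_filter_range, hfilter, Finset.card_insert_of_notMem (by simp),
      Finset.card_image_of_injective _ fun v w h => Fin.ext (Nat.succ_injective h), ha]
  have hcount' : Nat.count p (n + 2) = k + 2 := by
    rw [Nat.count_succ, hcount, if_pos (.inr (.inl (by omega)))]
  have hnth : ∀ m, p m → Nat.nth p (Nat.count p m) = m := fun m hm => Nat.nth_count hm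
  have hlast : Nat.nth p (k + 1) = n + 1 := hcount ▸ hnth _ (.inr (.inl (by omega)))
  refine ⟨Nat.nth p, (Nat.nth_strictMono hp).strictMonoOn _, by simpa using hnth 0 (.inl rfl),
    hlast, hcount' ▸ hnth _ (.inr (.inl (by omega))), fun w => ⟨fun hw => ?_, ?_⟩⟩
  · have hw' := hnth (w + 1) (.inr (.inr ⟨w, rfl, hw⟩))
    refine ⟨Nat.count p (w + 1), ?_, hw'⟩
    have := Nat.count_monotone p (show (w : ℕ) + 1 ≤ n + 1 by omega)
    omega
  · rintro ⟨i, -, hi⟩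
    have hmem : p (w + 1) := hi ▸ Nat.nth_mem_of_infinite hp i
    obtain h | h | ⟨w', h, hw'⟩ := hmem
    · omega
    · omega
    · rwa [show w = w' from Fin.ext (by omega)]

theorem gapCompat_iff {i j a b c d : ℕ} (hb : b < n + 3) (hd : d < n + 3) :
    GapCompat n k cl i (a * (n + 3) + b) j (c * (n + 3) + d) ↔
      a < b ∧ c < d ∧ (i = 0 → a = 0) ∧ (j = k + 1 → c = n + 1) ∧ (j = i + 1 → b = c) ∧
      ∀ w < n, ∀ s < 2, ∀ w' < n, ∀ s' < 2, cl ((w * 2 + s) * (n * 2) + (w' * 2 + s')) →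
        ¬ ((FalsifiedBy a b w s ∨ FalsifiedBy c d w s) ∧
          (FalsifiedBy a b w' s' ∨ FalsifiedBy c d w' s')) := by
  constructor
  · rintro ⟨a', -, b', hb', c', -, d', hd', hu, hv, h⟩
    have hdiv := congrArg (· / (n + 3)) hu
    have hmod := congrArg (· % (n + 3)) hu
    have hdiv' := congrArg (· / (n + 3)) hv
    have hmod' := congrArg (· % (n + 3)) hv
    simp only [mul_add_div_of_lt, mul_add_mod_of_lt, hb, hb', hd, hd'] at hdiv hmod hdiv' hmod'
    subst hdiv hmod hdiv' hmod'
    exact h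
  · intro h
    exact ⟨a, h.1.trans hb, b, hb, c, h.2.1.trans hd, d, hd, rfl, rfl, h⟩

theorem IsMarking.isSolution_iff (hs : IsMarking a k s) :
    IsSolution (k + 2) ((n + 3) * (n + 3)) (GapCompat n k cl)
      (fun i => s i * (n + 3) + s (i + 1)) ↔ Respects cl a := by
  constructor
  · intro hx l l' hl
    by_contra hno
    rw [not_or, ← hs.exists_falsifiedBy_iff, ← hs.exists_falsifiedBy_iff] at hno
    obtain ⟨⟨p, hp, hlp⟩, q, hq, hlq⟩ := hno
    obtain ⟨i, j, hij, hj, hpij, hqij⟩ :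
        ∃ i j, i < j ∧ j < k + 2 ∧ (p = i ∨ p = j) ∧ (q = i ∨ q = j) := by
      rcases lt_trichotomy p q with h | rfl | h
      · exact ⟨p, q, by omega⟩
      · rcases Nat.eq_zero_or_pos p with h | h
        · exact ⟨p, p + 1, by omega⟩
        · exact ⟨0, p, by omega⟩
      · exact ⟨q, p, by omega⟩
    have hcompat := (gapCompat_iff (hs.apply_lt (by omega)) (hs.apply_lt (by omega))).1
      (hx.compat i j hij hj)
    refine hcompat.2.2.2.2.2 l.1 l.1.2 l.2 l.2.2 l'.1 l'.1.2 l'.2 l'.2.2 hl ⟨?_, ?_⟩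
    · rcases hpij with rfl | rfl
      exacts [.inl hlp, .inr hlp]
    · rcases hqij with rfl | rfl
      exacts [.inl hlq, .inr hlq]
  · intro hcl
    refine ⟨fun i hi => mul_add_lt_mul (hs.apply_lt (by omega)) (hs.apply_lt (by omega)),
      fun i j hij hj => (gapCompat_iff (hs.apply_lt (by omega)) (hs.apply_lt (by omega))).2
        ⟨(hs.lt_iff_lt (by omega) (by omega)).2 (by omega),
        (hs.lt_iff_lt (by omega) (by omega)).2 (by omega), fun h => h ▸ hs.apply_zero,
        fun h => h ▸ hs.apply_penultimate, fun h => h ▸ rfl, ?_⟩⟩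
    intro w hw e he w' hw' e' he' hc ⟨h, h'⟩
    have hfalse : ∀ l : Literal n, FalsifiedBy (s i) (s (i + 1)) l.1 l.2 ∨
        FalsifiedBy (s j) (s (j + 1)) l.1 l.2 → ¬ l.Holds a := fun l hl =>
      (hs.exists_falsifiedBy_iff l).1 (hl.elim (fun h => ⟨i, by omega, h⟩) fun h => ⟨j, hj, h⟩)
    exact (hcl (⟨w, hw⟩, ⟨e, he⟩) (⟨w', hw'⟩, ⟨e', he'⟩) hc).elim (hfalse _ h) (hfalse _ h')

theorem exists_isMarking_of_isSolution {x : ℕ → ℕ}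
    (hx : IsSolution (k + 2) ((n + 3) * (n + 3)) (GapCompat n k cl) x) :
    ∃ (a : Fin n → Bool) (s : ℕ → ℕ), IsMarking a k s ∧
      ∀ i < k + 2, x i = s i * (n + 3) + s (i + 1) := by
  classical
  have hmod : ∀ i, x i % (n + 3) < n + 3 := fun i => Nat.mod_lt _ (by omega)
  have hcompat : ∀ i j, i < j → j < k + 2 →
      GapCompat n k cl i (x i / (n + 3) * (n + 3) + x i % (n + 3)) j
        (x j / (n + 3) * (n + 3) + x j % (n + 3)) := fun i j hij hj => by
    simpa only [Nat.div_add_mod'] using hx.compat i j hij hj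
  have hpair := fun i j hij hj => (gapCompat_iff (hmod i) (hmod j)).1 (hcompat i j hij hj)
  let s : ℕ → ℕ := fun
    | 0 => 0
    | i + 1 => x i % (n + 3)
  have hdiv : ∀ i < k + 2, x i / (n + 3) = s i := by
    rintro (_ | i) hi
    · exact (hpair 0 1 (by omega) (by omega)).2.2.1 rfl
    · exact ((hpair i (i + 1) (by omega) hi).2.2.2.2.1 rfl).symm
  have hlt : ∀ i < k + 2, s i < s (i + 1) := fun i hi => by
    rw [← hdiv i hi]
    rcases Nat.lt_or_ge i (k + 1) with h | h
    · exact (hpair i (k + 1) h (by omega)).1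
    · exact (hpair 0 i (by omega) hi).2.1
  have hpenultimate : s (k + 1) = n + 1 := by
    rw [← hdiv (k + 1) (by omega)]
    exact (hpair 0 (k + 1) (by omega) (by omega)).2.2.2.1 rfl
  let a : Fin n → Bool := fun w => decide (∃ i < k + 2, s i = w + 1)
  refine ⟨a, s, ⟨?_, rfl, hpenultimate, ?_, fun w => by simp only [a, decide_eq_true_iff]⟩,
    fun i hi => ?_⟩
  · exact strictMonoOn_of_lt_add_one Set.ordConnected_Iic fun i _ _ hi => hlt i hi
  · have : s (k + 1) < s (k + 2) := hlt (k + 1) (by omega)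
    have : s (k + 2) < n + 3 := hmod (k + 1)
    omega
  · rw [← hdiv i hi]
    exact (Nat.div_add_mod' _ _).symm

theorem exists_isSolution_gapCompat_iff :
    (∃ x, IsSolution (k + 2) ((n + 3) * (n + 3)) (GapCompat n k cl) x) ↔
      ∃ a : Fin n → Bool, Respects cl a ∧ (Finset.univ.filter fun v => a v = true).card = k := by
  constructor
  · rintro ⟨x, hx⟩
    obtain ⟨a, s, hs, hxs⟩ := exists_isMarking_of_isSolution hx
    refine ⟨a, hs.isSolution_iff.1 ⟨fun i hi => hxs i hi ▸ hx.lt i hi, fun i j hij hj => ?_⟩,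
      hs.card_eq⟩
    rw [← hxs i (by omega), ← hxs j hj]
    exact hx.compat i j hij hj
  · rintro ⟨a, hcl, hk⟩
    obtain ⟨s, hs⟩ := exists_isMarking hk
    exact ⟨_, hs.isSolution_iff.2 hcl⟩

end Gaps

/-! ## Matrices as strings -/

section Strings

variable {m k : ℕ} {y : List Bool}

theorem length_encodeMatrix (A : Fin m → Fin m → Bool) : (encodeMatrix A).length = m * m := by
  simp [encodeMatrix]

theorem getElem?_encodeMatrix (A : Fin m → Fin m → Bool) (i j : Fin m) :
    (encodeMatrix A)[(i : ℕ) * m + j]? = some (A i j) := by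
  have hlt : (i : ℕ) * m + j < m * m := mul_add_lt_mul i.2 j.2
  have hpos : (⟨(i : ℕ) * m + j, hlt⟩ : Fin (m * m)) = finProdFinEquiv (i, j) :=
    Fin.ext (by rw [finProdFinEquiv_apply_val]; ring)
  rw [encodeMatrix, List.getElem?_ofFn, dif_pos hlt, hpos, Equiv.symm_apply_apply]

theorem encodeMatrix_injective : Function.Injective (encodeMatrix (m := m)) := by
  intro A A' h
  funext i j
  have := getElem?_encodeMatrix A i j
  rw [h, getElem?_encodeMatrix] at this
  exact (Option.some.inj this).symm

theorem eq_encodeMatrix (hy : y.length = m * m) (A : Fin m → Fin m → Bool)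
    (hA : ∀ i j : Fin m, y[(i : ℕ) * m + j]? = some (A i j)) : y = encodeMatrix A := by
  apply List.ext_getElem?
  intro p
  rcases Nat.lt_or_ge p (m * m) with hp | hp
  · have hm : 0 < m := Nat.pos_of_ne_zero (by rintro rfl; simp at hp)
    have hi : p / m < m := Nat.div_lt_of_lt_mul hp
    have hj : p % m < m := Nat.mod_lt _ hm
    have hpos : p = (⟨p / m, hi⟩ : Fin m) * m + (⟨p % m, hj⟩ : Fin m) := (Nat.div_add_mod' p m).symm
    rw [hpos, hA, getElem?_encodeMatrix]
  · rw [List.getElem?_eq_none (by omega),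
      List.getElem?_eq_none (by rw [length_encodeMatrix]; omega)]

/-- The position `p` of the matrix `y` of a 2-CNF formula holds a clause. -/
def IsClauseAt (y : List Bool) (p : ℕ) : Prop := y[p]? = some true

theorem finProdFinEquiv_literal {n : ℕ} (l : Literal n) :
    ((finProdFinEquiv l : Fin (n * 2)) : ℕ) = l.1 * 2 + l.2 := by
  rw [finProdFinEquiv_apply_val]
  ring

theorem isClauseAt_encode {n : ℕ} (φ : TwoCNF n) (l l' : Literal n) :
    IsClauseAt φ.encode ((l.1 * 2 + l.2) * (n * 2) + (l'.1 * 2 + l'.2)) ↔ (l, l') ∈ φ := by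
  rw [IsClauseAt, ← finProdFinEquiv_literal, ← finProdFinEquiv_literal, TwoCNF.encode,
    getElem?_encodeMatrix]
  simp

theorem respects_isClauseAt_encode {n : ℕ} (φ : TwoCNF n) (a : Fin n → Bool) :
    Respects (IsClauseAt φ.encode) a ↔ φ.SatisfiedBy a := by
  simp only [Respects, isClauseAt_encode, TwoCNF.SatisfiedBy, Prod.forall]

theorem exists_eq_encode {n : ℕ} (hy : n * 2 * (n * 2) = y.length) :
    ∃ φ : TwoCNF n, y = φ.encode := by
  classical
  refine ⟨Finset.univ.filter fun c =>
    IsClauseAt y ((c.1.1 * 2 + c.1.2) * (n * 2) + (c.2.1 * 2 + c.2.2)),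
    eq_encodeMatrix hy.symm _ fun i j => ?_⟩
  have hlt : (i : ℕ) * (n * 2) + j < y.length := hy ▸ mul_add_lt_mul i.2 j.2
  obtain ⟨l, rfl⟩ := finProdFinEquiv.surjective i
  obtain ⟨l', rfl⟩ := finProdFinEquiv.surjective j
  rw [Equiv.symm_apply_apply, Equiv.symm_apply_apply, List.getElem?_eq_getElem hlt]
  simp only [Finset.mem_filter, Finset.mem_univ, true_and, IsClauseAt, ← finProdFinEquiv_literal,
    List.getElem?_eq_getElem hlt]
  simp

theorem mem_weightedTwoCNFSat_iff :
    (y, k) ∈ weightedTwoCNFSat ↔ ∃ n, n * 2 * (n * 2) = y.length ∧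
      ∃ a : Fin n → Bool, Respects (IsClauseAt y) a ∧
        (Finset.univ.filter fun v => a v = true).card = k := by
  constructor
  · rintro ⟨n, φ, rfl : y = _, a, ha, hk⟩
    exact ⟨n, (length_encodeMatrix _).symm, a, (respects_isClauseAt_encode φ a).2 ha, hk⟩
  · rintro ⟨n, hy, a, ha, hk⟩
    obtain ⟨φ, rfl⟩ := exists_eq_encode hy
    exact ⟨n, φ, rfl, a, (respects_isClauseAt_encode φ a).1 ha, hk⟩

/-- The number of variables of a formula that is encoded by a string of length `L`, written as a sum
that the language of expressions below can evaluate; it is `0` if there is no such formula. -/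
def numVars (L : ℕ) : ℕ := ∑ m ∈ Finset.range (L + 1), if m * 2 * (m * 2) = L then m else 0

theorem numVars_eq {n L : ℕ} (h : n * 2 * (n * 2) = L) : numVars L = n := by
  subst h
  have hinj : ∀ m, m * 2 * (m * 2) = n * 2 * (n * 2) → m = n := fun m hm => by
    have := Nat.mul_self_inj.1 hm
    omega
  rw [numVars, Finset.sum_eq_single n, if_pos rfl]
  · exact fun m _ hm => if_neg fun h => hm (hinj m h)
  · exact fun hn => absurd (Finset.mem_range.2 (by nlinarith)) hn

/-- The constraints for the instance `(y, k)`; they are unsatisfiable if the length of `y` is not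
that of the code of a formula. -/
def InstanceCompat (y : List Bool) (k i u j v : ℕ) : Prop :=
  numVars y.length * 2 * (numVars y.length * 2) = y.length ∧
    GapCompat (numVars y.length) k (IsClauseAt y) i u j v

/-- The number of values of each variable of the constraint satisfaction problem for a string of
length `L`. -/
def domainSize (L : ℕ) : ℕ := (numVars L + 3) * (numVars L + 3)

theorem mem_weightedTwoCNFSat_iff_hasDisjointCycles_grid :
    (y, k) ∈ weightedTwoCNFSat ↔ (grid (k + 2) (domainSize y.length)
      (InstanceCompat y k)).HasDisjointCycles ((k + 2) * (k + 2)) := by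
  rw [hasDisjointCycles_grid_iff (by simp [domainSize]), mem_weightedTwoCNFSat_iff]
  constructor
  · rintro ⟨n, hn, ha⟩
    obtain rfl := numVars_eq hn
    obtain ⟨x, hx⟩ := exists_isSolution_gapCompat_iff.2 ha
    exact ⟨x, hx.lt, fun i j hij hj => ⟨hn, hx.compat i j hij hj⟩⟩
  · rintro ⟨x, hx⟩
    exact ⟨_, (hx.compat 0 1 (by omega) (by omega)).1, exists_isSolution_gapCompat_iff.1
      ⟨x, hx.lt, fun i j hij hj => (hx.compat i j hij hj).2⟩⟩

end Strings

/-! ## Numbering the grid and its Eulerian extension -/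

theorem mul_add_inj {m i j i' j' : ℕ} (hj : j < m) (hj' : j' < m)
    (h : i * m + j = i' * m + j') : i = i' ∧ j = j' := by
  have hdiv := congrArg (· / m) h
  have hmod := congrArg (· % m) h
  simp only [mul_add_div_of_lt hj, mul_add_div_of_lt hj', mul_add_mod_of_lt hj,
    mul_add_mod_of_lt hj'] at hdiv hmod
  exact ⟨hdiv, hmod⟩

/-- The number of proper vertices of the grid. -/
def gridSize (K M : ℕ) : ℕ := K * K + K * K + K * (M * K + 2) * 2

/-- The number that a proper vertex of the grid has in the enumeration of the roots, the mates
(including the unused ones) and the nodes, in this order. -/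
def gridCode (K M : ℕ) : GridVertex → ℕ
  | .root i j => i * K + j
  | .mate i j => K * K + (i * K + j)
  | .node i t l => K * K + K * K + ((i * (M * K + 2) + t) * 2 + l)

section GridCode

variable {K M : ℕ} {compat : ℕ → ℕ → ℕ → ℕ → Prop} {k : ℕ}

theorem gridCode_lt {a : GridVertex} (ha : IsProper K M a) : gridCode K M a < gridSize K M := by
  unfold gridSize
  cases a with
  | root i j =>
    have : i * K + j < K * K := mul_add_lt_mul ha.1 ha.2
    rw [gridCode]; omega
  | mate i j =>
    have : i * K + j < K * K := mul_add_lt_mul ha.1 ha.2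
    rw [gridCode]; omega
  | node i t l =>
    have : (i * (M * K + 2) + t) * 2 + l < K * (M * K + 2) * 2 :=
      mul_add_lt_mul (mul_add_lt_mul ha.1 (Nat.lt_succ_of_le ha.2.1)) ha.2.2
    rw [gridCode]; omega

theorem gridCode_injOn : Set.InjOn (gridCode K M) {a | IsProper K M a} := by
  have hlt : ∀ {i j}, i < K ∧ j < K → i * K + j < K * K := fun h => mul_add_lt_mul h.1 h.2
  rintro (⟨i, j⟩ | ⟨i, j⟩ | ⟨i, t, l⟩) ha (⟨i', j'⟩ | ⟨i', j'⟩ | ⟨i', t', l'⟩) hb h <;>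
    simp only [gridCode] at h
  case root.root =>
    obtain ⟨rfl, rfl⟩ := mul_add_inj ha.2 hb.2 h
    rfl
  case mate.mate =>
    obtain ⟨rfl, rfl⟩ := mul_add_inj ha.2 hb.2 (Nat.add_left_cancel h)
    rfl
  case node.node =>
    obtain ⟨hit, rfl⟩ := mul_add_inj ha.2.2 hb.2.2 (Nat.add_left_cancel h)
    obtain ⟨rfl, rfl⟩ := mul_add_inj (Nat.lt_succ_of_le ha.2.1) (Nat.lt_succ_of_le hb.2.1) hit
    rfl
  case root.mate => exact absurd (hlt ha) (by omega)
  case root.node => exact absurd (hlt ha) (by omega)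
  case mate.root => exact absurd (hlt hb) (by omega)
  case mate.node => exact absurd (hlt ha) (by omega)
  case node.root => exact absurd (hlt hb) (by omega)
  case node.mate => exact absurd (hlt hb) (by omega)

/-- The grid, with its proper vertices numbered. -/
def finGrid (K M : ℕ) (compat : ℕ → ℕ → ℕ → ℕ → Prop) : Digraph (Fin (gridSize K M)) :=
  relabel (grid K M compat) (gridCode K M) (gridSize K M)

theorem finGrid_loopless : (finGrid K M compat).Loopless :=
  relabel_loopless grid_loopless fun _ _ huv hcode =>
    gridCode_injOn (GridAdj.isProper huv).1 (GridAdj.isProper huv).2 hcode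

theorem hasDisjointCycles_finGrid_iff (hK : 0 < K) :
    (finGrid K M compat).HasDisjointCycles k ↔ (grid K M compat).HasDisjointCycles k :=
  hasDisjointCycles_relabel_iff (S := {a | IsProper K M a}) ⟨.root 0 0, hK, hK⟩
    (fun _ _ => GridAdj.isProper) gridCode_injOn fun _ => gridCode_lt

theorem gridSize_pos (hK : 0 < K) : 0 < gridSize K M := by
  have := Nat.mul_pos hK hK
  rw [gridSize]
  omega

/-- The arcs of the numbered grid, as a bounded formula. -/
def GridArc (K M : ℕ) (compat : ℕ → ℕ → ℕ → ℕ → Prop) (p q : ℕ) : Prop :=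
  let root i j := gridCode K M (.root i j)
  let mate i j := gridCode K M (.mate i j)
  let node i t l := gridCode K M (.node i t l)
  ∃ i < K,
    (p = root i i ∧ q = node i 0 0) ∨
    (p = node i (M * K + 1) 1 ∧ q = root i i) ∨
    (∃ t < M * K + 1, ∃ l < 2, p = node i t l ∧ q = node i (t + 1) l) ∨
    (∃ t < M * K + 2, p = node i t 0 ∧ q = node i t 1) ∨
    (∃ v < M, p = node i (v * K) 0 ∧ q = node i (v * K + K + 1) 1) ∨
    ∃ j < K,
      (i < j ∧
        ((∃ u < M, p = root i j ∧ q = node i (u * K + j + 1) 0) ∨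
        (∃ u < M, ∃ v < M, compat i u j v ∧
          p = node i (u * K + j + 1) 1 ∧ q = node j (v * K + i + 1) 0) ∨
        ∃ v < M, p = node j (v * K + i + 1) 1 ∧ q = root i j)) ∨
      (j < i ∧ ((p = root i j ∧ q = mate i j) ∨ (p = mate i j ∧ q = root i j)))

theorem GridArc.exists_gridAdj {p q : ℕ} (h : GridArc K M compat p q) :
    ∃ a b, GridAdj K M compat a b ∧ gridCode K M a = p ∧ gridCode K M b = q := by
  rcases h with ⟨i, hi, ⟨rfl, rfl⟩ | ⟨rfl, rfl⟩ | ⟨t, ht, l, hl, rfl, rfl⟩ | ⟨t, ht, rfl, rfl⟩ |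
    ⟨v, hv, rfl, rfl⟩ | ⟨j, hj, ⟨hij, ⟨u, hu, rfl, rfl⟩ | ⟨u, hu, v, hv, huv, rfl, rfl⟩ |
    ⟨v, hv, rfl, rfl⟩⟩ | ⟨hji, ⟨rfl, rfl⟩ | ⟨rfl, rfl⟩⟩⟩⟩
  · exact ⟨_, _, .start hi, rfl, rfl⟩
  · exact ⟨_, _, .finish hi, rfl, rfl⟩
  · exact ⟨_, _, .step hi (Nat.le_of_lt_succ ht) hl, rfl, rfl⟩
  · exact ⟨_, _, .down hi (Nat.le_of_lt_succ ht), rfl, rfl⟩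
  · exact ⟨_, _, .skip hi hv, rfl, rfl⟩
  · exact ⟨_, _, .enter hij hj hu, rfl, rfl⟩
  · exact ⟨_, _, .cross hij hj hu hv huv, rfl, rfl⟩
  · exact ⟨_, _, .exit hij hj hv, rfl, rfl⟩
  · exact ⟨_, _, .toMate hji hi, rfl, rfl⟩
  · exact ⟨_, _, .ofMate hji hi, rfl, rfl⟩

theorem GridAdj.gridArc {a b : GridVertex} (hab : GridAdj K M compat a b) :
    GridArc K M compat (gridCode K M a) (gridCode K M b) := by
  cases hab with
  | start hi => exact ⟨_, hi, .inl ⟨rfl, rfl⟩⟩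
  | finish hi => exact ⟨_, hi, .inr <| .inl ⟨rfl, rfl⟩⟩
  | step hi ht hl =>
    exact ⟨_, hi, .inr <| .inr <| .inl ⟨_, Nat.lt_succ_of_le ht, _, hl, rfl, rfl⟩⟩
  | down hi ht =>
    exact ⟨_, hi, .inr <| .inr <| .inr <| .inl ⟨_, Nat.lt_succ_of_le ht, rfl, rfl⟩⟩
  | skip hi hv => exact ⟨_, hi, .inr <| .inr <| .inr <| .inr <| .inl ⟨_, hv, rfl, rfl⟩⟩
  | enter hij hj hu =>
    exact ⟨_, hij.trans hj, .inr <| .inr <| .inr <| .inr <| .inr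
      ⟨_, hj, .inl ⟨hij, .inl ⟨_, hu, rfl, rfl⟩⟩⟩⟩
  | cross hij hj hu hv huv =>
    exact ⟨_, hij.trans hj, .inr <| .inr <| .inr <| .inr <| .inr
      ⟨_, hj, .inl ⟨hij, .inr <| .inl ⟨_, hu, _, hv, huv, rfl, rfl⟩⟩⟩⟩
  | exit hij hj hv =>
    exact ⟨_, hij.trans hj, .inr <| .inr <| .inr <| .inr <| .inr
      ⟨_, hj, .inl ⟨hij, .inr <| .inr ⟨_, hv, rfl, rfl⟩⟩⟩⟩
  | toMate hji hi =>
    exact ⟨_, hi, .inr <| .inr <| .inr <| .inr <| .inr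
      ⟨_, hji.trans hi, .inr ⟨hji, .inl ⟨rfl, rfl⟩⟩⟩⟩
  | ofMate hji hi =>
    exact ⟨_, hi, .inr <| .inr <| .inr <| .inr <| .inr
      ⟨_, hji.trans hi, .inr ⟨hji, .inr ⟨rfl, rfl⟩⟩⟩⟩

end GridCode

section EulerCode

variable {N : ℕ} {arc : ℕ → ℕ → Prop}

/-- The number of vertices of the Eulerian extension of a digraph with `N` vertices. -/
abbrev eulerSize (N : ℕ) : ℕ := N + (N * N + (N * N + 1))

/-- The vertices of the Eulerian extension of a digraph on `V`, by their kinds. -/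
def eulerVertexEquivSum (V : Type*) : EulerVertex V ≃ V ⊕ V × V ⊕ V × V ⊕ Fin 1 where
  toFun
    | .base v => .inl v
    | .toHub u v => .inr (.inl (u, v))
    | .fromHub u v => .inr (.inr (.inl (u, v)))
    | .hub => .inr (.inr (.inr 0))
  invFun
    | .inl v => .base v
    | .inr (.inl (u, v)) => .toHub u v
    | .inr (.inr (.inl (u, v))) => .fromHub u v
    | .inr (.inr (.inr _)) => .hub
  left_inv := by rintro (_ | _ | _ | _) <;> rfl
  right_inv := by rintro (_ | _ | _ | p) <;> simp [Fin.fin_one_eq_zero]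

/-- The numbering of the vertices of the Eulerian extension of a digraph on `0, …, N - 1`. -/
def eulerEquiv (N : ℕ) : EulerVertex (Fin N) ≃ Fin (eulerSize N) :=
  (eulerVertexEquivSum (Fin N)).trans <|
    (Equiv.sumCongr (.refl _) <| (Equiv.sumCongr finProdFinEquiv <|
      (Equiv.sumCongr finProdFinEquiv (.refl _)).trans finSumFinEquiv).trans
        finSumFinEquiv).trans finSumFinEquiv

theorem eulerEquiv_base (v : Fin N) : (eulerEquiv N (.base v) : ℕ) = v := by
  simp [eulerEquiv, eulerVertexEquivSum]

theorem eulerEquiv_toHub (u v : Fin N) : (eulerEquiv N (.toHub u v) : ℕ) = N + (u * N + v) := by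
  simp [eulerEquiv, eulerVertexEquivSum, add_comm, mul_comm]

theorem eulerEquiv_fromHub (u v : Fin N) :
    (eulerEquiv N (.fromHub u v) : ℕ) = N + (N * N + (u * N + v)) := by
  simp [eulerEquiv, eulerVertexEquivSum, add_comm, mul_comm]

theorem eulerEquiv_hub : (eulerEquiv N .hub : ℕ) = N + (N * N + N * N) := by
  simp [eulerEquiv, eulerVertexEquivSum]

/-- The arcs of the numbered Eulerian extension of the digraph with the arc relation `arc` on
`0, …, N - 1`, as a bounded formula. -/
def EulerArc (N : ℕ) (arc : ℕ → ℕ → Prop) (p q : ℕ) : Prop :=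
  let toHub u v := N + (u * N + v)
  let fromHub u v := N + (N * N + (u * N + v))
  let hub := N + (N * N + N * N)
  ∃ u < N,
    (p = u ∧ q = hub) ∨
    (p = hub ∧ q = u) ∨
    ∃ v < N,
      (p = toHub u v ∧ q = hub) ∨
      (p = hub ∧ q = fromHub u v) ∨
      (arc u v ∧
        ((p = u ∧ q = v) ∨ (p = v ∧ q = toHub u v) ∨ (p = fromHub u v ∧ q = u))) ∨
      (¬arc u v ∧ ((p = hub ∧ q = toHub u v) ∨ (p = fromHub u v ∧ q = hub)))

variable {D : Digraph (Fin N)}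

theorem EulerArc.exists_eulerAdj (hD : ∀ u v : Fin N, arc u v ↔ D.Adj u v) {p q : ℕ}
    (h : EulerArc N arc p q) :
    ∃ a b, EulerAdj D a b ∧ (eulerEquiv N a : ℕ) = p ∧ (eulerEquiv N b : ℕ) = q := by
  obtain ⟨u, hu, h⟩ := h
  lift u to Fin N using hu
  rcases h with ⟨rfl, rfl⟩ | ⟨rfl, rfl⟩ | ⟨v, hv, h⟩
  · exact ⟨_, _, .ascend u, eulerEquiv_base u, eulerEquiv_hub⟩
  · exact ⟨_, _, .descend u, eulerEquiv_hub, eulerEquiv_base u⟩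
  lift v to Fin N using hv
  rw [hD] at h
  rcases h with ⟨rfl, rfl⟩ | ⟨rfl, rfl⟩ | ⟨h, ⟨rfl, rfl⟩ | ⟨rfl, rfl⟩ | ⟨rfl, rfl⟩⟩ |
    ⟨h, ⟨rfl, rfl⟩ | ⟨rfl, rfl⟩⟩
  · exact ⟨_, _, .arrive u v, eulerEquiv_toHub u v, eulerEquiv_hub⟩
  · exact ⟨_, _, .depart u v, eulerEquiv_hub, eulerEquiv_fromHub u v⟩
  · exact ⟨_, _, .arc h, eulerEquiv_base u, eulerEquiv_base v⟩
  · exact ⟨_, _, .leave h, eulerEquiv_base v, eulerEquiv_toHub u v⟩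
  · exact ⟨_, _, .enter h, eulerEquiv_fromHub u v, eulerEquiv_base u⟩
  · exact ⟨_, _, .back h, eulerEquiv_hub, eulerEquiv_toHub u v⟩
  · exact ⟨_, _, .goBack h, eulerEquiv_fromHub u v, eulerEquiv_hub⟩

theorem EulerAdj.eulerArc (hD : ∀ u v : Fin N, arc u v ↔ D.Adj u v) {a b : EulerVertex (Fin N)}
    (hab : EulerAdj D a b) : EulerArc N arc (eulerEquiv N a) (eulerEquiv N b) := by
  cases hab with
  | ascend v => exact ⟨v, v.2, .inl ⟨eulerEquiv_base v, eulerEquiv_hub⟩⟩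
  | descend v => exact ⟨v, v.2, .inr <| .inl ⟨eulerEquiv_hub, eulerEquiv_base v⟩⟩
  | arrive u v =>
    exact ⟨u, u.2, .inr <| .inr ⟨v, v.2, .inl ⟨eulerEquiv_toHub u v, eulerEquiv_hub⟩⟩⟩
  | depart u v =>
    exact ⟨u, u.2, .inr <| .inr ⟨v, v.2, .inr <| .inl ⟨eulerEquiv_hub, eulerEquiv_fromHub u v⟩⟩⟩
  | @arc u v h =>
    exact ⟨u, u.2, .inr <| .inr ⟨v, v.2, .inr <| .inr <| .inl
      ⟨(hD u v).2 h, .inl ⟨eulerEquiv_base u, eulerEquiv_base v⟩⟩⟩⟩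
  | @leave u v h =>
    exact ⟨u, u.2, .inr <| .inr ⟨v, v.2, .inr <| .inr <| .inl
      ⟨(hD u v).2 h, .inr <| .inl ⟨eulerEquiv_base v, eulerEquiv_toHub u v⟩⟩⟩⟩
  | @enter u v h =>
    exact ⟨u, u.2, .inr <| .inr ⟨v, v.2, .inr <| .inr <| .inl
      ⟨(hD u v).2 h, .inr <| .inr ⟨eulerEquiv_fromHub u v, eulerEquiv_base u⟩⟩⟩⟩
  | @back u v h =>
    exact ⟨u, u.2, .inr <| .inr ⟨v, v.2, .inr <| .inr <| .inr
      ⟨mt (hD u v).1 h, .inl ⟨eulerEquiv_hub, eulerEquiv_toHub u v⟩⟩⟩⟩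
  | @goBack u v h =>
    exact ⟨u, u.2, .inr <| .inr ⟨v, v.2, .inr <| .inr <| .inr
      ⟨mt (hD u v).1 h, .inr ⟨eulerEquiv_fromHub u v, eulerEquiv_hub⟩⟩⟩⟩

end EulerCode

section EulerGrid

variable {K M : ℕ} {compat : ℕ → ℕ → ℕ → ℕ → Prop} {k : ℕ}

/-- The Eulerian extension of the numbered grid, with its vertices numbered. -/
def finEuler (K M : ℕ) (compat : ℕ → ℕ → ℕ → ℕ → Prop) : Digraph (Fin (eulerSize (gridSize K M))) :=
  relabel (eulerize (finGrid K M compat)) (fun a => eulerEquiv _ a) _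

theorem finEuler_adj {p q : Fin (eulerSize (gridSize K M))} :
    (finEuler K M compat).Adj p q ↔ EulerArc (gridSize K M) (GridArc K M compat) p q := by
  have harc : ∀ u v : Fin (gridSize K M), GridArc K M compat u v ↔ (finGrid K M compat).Adj u v :=
    fun u v => ⟨fun h => h.exists_gridAdj, fun ⟨_, _, hab, hu, hv⟩ => hu ▸ hv ▸ hab.gridArc⟩
  exact ⟨fun ⟨_, _, hab, hp, hq⟩ => hp ▸ hq ▸ EulerAdj.eulerArc harc hab,
    fun h => h.exists_eulerAdj harc⟩

theorem finEuler_loopless : (finEuler K M compat).Loopless :=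
  relabel_loopless (eulerize_loopless finGrid_loopless) fun _ _ _ hcode =>
    (eulerEquiv _).injective (Fin.ext hcode)

theorem finEuler_isEuler : (finEuler K M compat).IsEuler :=
  relabel_isEuler _ eulerize_isEuler

theorem hasDisjointCycles_finEuler_iff (hK : 0 < K) :
    (finEuler K M compat).HasDisjointCycles (k + 1) ↔ (grid K M compat).HasDisjointCycles k := by
  have : Nonempty (Fin (gridSize K M)) := ⟨⟨0, gridSize_pos hK⟩⟩
  rw [← hasDisjointCycles_finGrid_iff hK, ← hasDisjointCycles_eulerize_iff finGrid_loopless]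
  exact hasDisjointCycles_relabel_iff (S := Set.univ) ⟨.hub, trivial⟩
    (fun _ _ _ => ⟨trivial, trivial⟩)
    (fun _ _ _ _ hcode => (eulerEquiv _).injective (Fin.ext hcode)) fun a _ => (eulerEquiv _ a).2

end EulerGrid

theorem encode_mem_vertexDisjointCycles_iff {n k : ℕ} {D : Digraph (Fin n)} (hD : D.Loopless) :
    (D.encode, k) ∈ vertexDisjointCycles ↔ D.HasDisjointCycles k := by
  refine ⟨?_, fun h => ⟨n, D, hD, rfl, h⟩⟩
  rintro ⟨n', D', -, h : D.encode = D'.encode, hk⟩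
  obtain rfl : n = n' := by
    have hlength := congrArg List.length h
    simp only [encode, length_encodeMatrix] at hlength
    exact Nat.mul_self_inj.1 hlength
  obtain rfl : D = D' := by
    ext u v
    simpa using congrFun (congrFun (encodeMatrix_injective h) u) v
  exact hk

end ParamComplexity

/-! ## Arithmetic expressions and their compilation -/

namespace RAM

@[simp]
theorem State.setReg_reg (s : State) (r v : ℕ) : (s.setReg r v).reg = Function.update s.reg r v :=
  rfl

@[simp]
theorem State.setReg_arr (s : State) (r v : ℕ) : (s.setReg r v).arr = s.arr := rfl

/-- The two states have the same arrays and the same registers before the register `t`. -/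
def State.EqBelow (t : ℕ) (s s' : State) : Prop :=
  s'.arr = s.arr ∧ ∀ r < t, s'.reg r = s.reg r

theorem State.EqBelow.trans {t : ℕ} {s s' s'' : State} (h : s.EqBelow t s')
    (h' : s'.EqBelow t s'') : s.EqBelow t s'' :=
  ⟨h'.1.trans h.1, fun r hr => (h'.2 r hr).trans (h.2 r hr)⟩

theorem State.EqBelow.mono {t u : ℕ} {s s' : State} (h : s.EqBelow u s') (htu : t ≤ u) :
    s.EqBelow t s' :=
  ⟨h.1, fun r hr => h.2 r (hr.trans_le htu)⟩

theorem Exec.loop_count {r : ℕ} {p : Prog} {N : ℕ} {I : ℕ → State → Prop} {c : ℕ → ℕ}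
    (hstep : ∀ i < N, ∀ s, I i s → s.reg r ≠ 0 ∧ ∃ n s', Exec p s n s' ∧ n ≤ c i ∧ I (i + 1) s')
    (hdone : ∀ s, I N s → s.reg r = 0) {s : State} (hs : I 0 s) :
    ∃ n s', Exec (.loop r p) s n s' ∧ n ≤ ∑ j ∈ Finset.range N, (c j + 1) + 1 ∧ I N s' := by
  suffices h : ∀ m i s, i + m = N → I i s → ∃ n s', Exec (.loop r p) s n s' ∧
      n ≤ ∑ j ∈ Finset.range m, (c (i + j) + 1) + 1 ∧ I N s' by
    simpa using h N 0 s (Nat.zero_add N) hs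
  intro m
  induction m with
  | zero =>
    rintro i s rfl hi
    exact ⟨1, s, .loopDone (hdone s hi), by simp, hi⟩
  | succ m ih =>
    intro i s hN hi
    obtain ⟨hr, n, s', hp, hn, hi'⟩ := hstep i (by omega) s hi
    obtain ⟨n', s'', hp', hn', hi''⟩ := ih (i + 1) s' (by omega) hi'
    refine ⟨1 + n + n', s'', .loopStep hr hp hp', ?_, hi''⟩
    rw [Finset.sum_range_succ']
    simp only [Nat.add_zero, ← Nat.add_assoc, Nat.add_right_comm i _ 1] at hn' ⊢
    omega

/-- Started in the state `s`, the program `p` puts the value `v` into the register `t` within `c`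
steps, and changes neither the arrays nor the registers before `t`. -/
def Evaluates (p : Prog) (t : ℕ) (s : State) (v c : ℕ) : Prop :=
  ∃ n s', Exec p s n s' ∧ n ≤ c ∧ s.EqBelow t s' ∧ s'.reg t = v

/-- A program for `reg r := reg a`, where `a ≠ r`. -/
def copy (r a : ℕ) : Prog := .seq (.const r 0) (.add r a r)

/-- A program for `reg t := reg t * reg (t + 1)`. -/
def multiply (t : ℕ) : Prog :=
  .seq (.const (t + 2) 0) (.seq (.const (t + 3) 1) (.seq
    (.loop t (.seq (.add (t + 2) (t + 2) (t + 1)) (.sub t t (t + 3)))) (copy t (t + 2))))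

/-- A program that replaces `reg t` by `1` if the cell of array `1` with this index holds `2`, and
by `0` otherwise. -/
def testBit (t : ℕ) : Prog :=
  .seq (.load t 1 t) (.seq (.const (t + 1) 2) (.seq (.sub (t + 2) t (t + 1))
    (.seq (.sub (t + 3) (t + 1) t) (.seq (.add t (t + 2) (t + 3))
      (.seq (.const (t + 1) 1) (.sub t (t + 1) t))))))

/-- A program that adds up in `reg t` what `p` puts into `reg (t + 3)`, where `reg x` runs through
the numbers below the original value of `reg t`. The original value of `reg x` is saved in
`reg (t + 1)` and finally restored. -/
def sumOver (x t : ℕ) (p : Prog) : Prog :=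
  .seq (copy (t + 1) x) (.seq (.const (t + 2) 0) (.seq (.const x 0) (.seq
    (.loop t (.seq p (.seq (.add (t + 2) (t + 2) (t + 3))
      (.seq (.const (t + 3) 1) (.seq (.add x x (t + 3)) (.sub t t (t + 3)))))))
    (.seq (copy x (t + 1)) (copy t (t + 2))))))

theorem Exec.copy (s : State) {r a : ℕ} (h : a ≠ r) :
    Exec (copy r a) s 2 (s.setReg r (s.reg a)) := by
  have hseq := Exec.seq (Exec.const s r 0) (Exec.add (s.setReg r 0) r a r)
  simpa [RAM.copy, State.setReg, h] using hseq

theorem Evaluates.seq {p q : Prog} {t : ℕ} {s : State} {v w c d : ℕ} (hp : Evaluates p t s v c)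
    (hq : ∀ s', s.EqBelow t s' → s'.reg t = v → Evaluates q t s' w d) :
    Evaluates (.seq p q) t s w (c + d) := by
  obtain ⟨n, s', hexec, hn, heq, hv⟩ := hp
  obtain ⟨n', s'', hexec', hn', heq', hw⟩ := hq s' heq hv
  exact ⟨n + n', s'', .seq hexec hexec', by omega, heq.trans heq', hw⟩

/-- The value `v` of the first operand survives the evaluation of the second one, because that one
only uses registers from `t + 1` on. -/
theorem Evaluates.operands {p q r : Prog} {t : ℕ} {s : State} {v w z c d e : ℕ}
    (hp : Evaluates p t s v c) (hq : ∀ s', s.EqBelow t s' → Evaluates q (t + 1) s' w d)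
    (hr : ∀ s', s'.reg t = v → s'.reg (t + 1) = w → Evaluates r t s' z e) :
    Evaluates (.seq p (.seq q r)) t s z (c + d + e) := by
  rw [add_assoc]
  refine hp.seq fun s' heq hv => ?_
  obtain ⟨n, s₁, hexec, hn, heq₁, hw⟩ := hq s' heq
  obtain ⟨n', s₂, hexec', hn', heq₂, hz⟩ := hr s₁ ((heq₁.2 t t.lt_succ_self).trans hv) hw
  exact ⟨n + n', s₂, .seq hexec hexec', by omega, (heq₁.mono t.le_succ).trans heq₂, hz⟩

section Instructions

variable (s : State) (t : ℕ)

theorem evaluates_copy {a : ℕ} (ha : a < t) : Evaluates (copy t a) t s (s.reg a) 2 :=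
  ⟨2, _, .copy s ha.ne, le_rfl, ⟨rfl, fun r hr => by simp [hr.ne]⟩, by simp⟩

theorem evaluates_const (c : ℕ) : Evaluates (.const t c) t s c 1 :=
  ⟨1, _, .const s t c, le_rfl, ⟨rfl, fun r hr => by simp [hr.ne]⟩, by simp⟩

theorem evaluates_add (a b : ℕ) : Evaluates (.add t a b) t s (s.reg a + s.reg b) 1 :=
  ⟨1, _, .add s t a b, le_rfl, ⟨rfl, fun r hr => by simp [hr.ne]⟩, by simp⟩

theorem evaluates_sub (a b : ℕ) : Evaluates (.sub t a b) t s (s.reg a - s.reg b) 1 :=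
  ⟨1, _, .sub s t a b, le_rfl, ⟨rfl, fun r hr => by simp [hr.ne]⟩, by simp⟩

theorem evaluates_multiply :
    Evaluates (multiply t) t s (s.reg t * s.reg (t + 1)) (s.reg t * 3 + 5) := by
  obtain ⟨n, s', hexec, hn, harr, -, hprod, -, -, hreg⟩ := Exec.loop_count (r := t)
    (p := .seq (.add (t + 2) (t + 2) (t + 1)) (.sub t t (t + 3))) (N := s.reg t) (c := fun _ => 2)
    (I := fun i s' => s'.arr = s.arr ∧ s'.reg t = s.reg t - i ∧
      s'.reg (t + 2) = i * s.reg (t + 1) ∧ s'.reg (t + 1) = s.reg (t + 1) ∧ s'.reg (t + 3) = 1 ∧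
      ∀ r < t, s'.reg r = s.reg r)
    (s := (s.setReg (t + 2) 0).setReg (t + 3) 1)
    (by
      rintro i hi s' ⟨harr, hcount, hprod, hfactor, hone, hreg⟩
      refine ⟨by omega, _, _, .seq (.add _ _ _ _) (.sub _ _ _ _), le_rfl, harr, ?_⟩
      simp only [State.setReg_reg]
      grind [Function.update_apply])
    (by grind)
    (by
      simp only [State.setReg_reg, State.setReg_arr]
      grind [Function.update_apply])
  refine ⟨_, _, .seq (.const _ _ _) (.seq (.const _ _ _) (.seq hexec (.copy _ (by omega)))), ?_,
    ⟨harr, fun r hr => ?_⟩, ?_⟩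
  · simp only [Nat.reduceAdd, Finset.sum_const, Finset.card_range, smul_eq_mul] at hn
    omega
  · simp [hr.ne, hreg r hr]
  · simp [hprod]

theorem evaluates_testBit :
    Evaluates (testBit t) t s (if s.arr 1 (s.reg t) = 2 then 1 else 0) 7 := by
  refine ⟨7, _, .seq (.load _ _ _ _) (.seq (.const _ _ _) (.seq (.sub _ _ _ _)
    (.seq (.sub _ _ _ _) (.seq (.add _ _ _ _) (.seq (.const _ _ _) (.sub _ _ _ _)))))),
    le_rfl, ⟨rfl, fun r hr => ?_⟩, ?_⟩
  · simp only [State.setReg_reg]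
    grind [Function.update_apply]
  · simp only [State.setReg_reg]
    grind [Function.update_apply]

end Instructions

theorem evaluates_sumOver {p : Prog} {s : State} {t x : ℕ} (hx : x < t) (v c : ℕ → ℕ)
    (hp : ∀ i s', (s.setReg x i).EqBelow t s' → Evaluates p (t + 3) s' (v i) (c i)) :
    Evaluates (sumOver x t p) t s (∑ i ∈ Finset.range (s.reg t), v i)
      (∑ i ∈ Finset.range (s.reg t), (c i + 5) + 9) := by
  obtain ⟨n, s', hexec, hn, heq, -, hsum, hsaved⟩ := Exec.loop_count (r := t)
    (p := .seq p (.seq (.add (t + 2) (t + 2) (t + 3))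
      (.seq (.const (t + 3) 1) (.seq (.add x x (t + 3)) (.sub t t (t + 3))))))
    (N := s.reg t) (c := fun i => c i + 4)
    (I := fun i s' => (s.setReg x i).EqBelow t s' ∧ s'.reg t = s.reg t - i ∧
      s'.reg (t + 2) = ∑ j ∈ Finset.range i, v j ∧ s'.reg (t + 1) = s.reg x)
    (s := ((s.setReg (t + 1) (s.reg x)).setReg (t + 2) 0).setReg x 0)
    (by
      rintro i hi s₁ ⟨heq, hcount, hsum, hsaved⟩
      obtain ⟨n, s₂, hexec, hn, heq₂, hv⟩ := hp i s₁ heq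
      have hne : s₁.reg t ≠ 0 := by omega
      have hreg (r : ℕ) (hr : r < t) : s₂.reg r = if r = x then i else s.reg r := by
        rw [heq₂.2 r (by omega), heq.2 r hr, State.setReg_reg, Function.update_apply]
      rw [← heq₂.2 t (by omega)] at hcount
      rw [← heq₂.2 (t + 2) (by omega)] at hsum
      rw [← heq₂.2 (t + 1) (by omega)] at hsaved
      refine ⟨hne, _, _, .seq hexec (.seq (.add _ _ _ _) (.seq (.const _ _ _)
        (.seq (.add _ _ _ _) (.sub _ _ _ _)))), by omega, ⟨heq₂.1.trans heq.1, fun r hr => ?_⟩,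
        ?_, ?_, ?_⟩
      all_goals simp only [State.setReg_reg, Function.update_apply, Finset.sum_range_succ]
      all_goals grind)
    (by grind)
    (by
      simp only [State.EqBelow, State.setReg_reg, State.setReg_arr, Finset.sum_range_zero]
      grind [Function.update_apply])
  refine ⟨_, _, .seq (.copy _ (by omega)) (.seq (.const _ _ _) (.seq (.const _ _ _)
    (.seq hexec (.seq (.copy _ (by omega)) (.copy _ (by omega)))))), ?_,
    ⟨heq.1, fun r hr => ?_⟩, ?_⟩
  · simp only [Nat.add_assoc, Nat.reduceAdd] at hn ⊢
    omega
  · have hreg := heq.2 r hr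
    simp only [State.setReg_reg, Function.update_apply] at hreg ⊢
    grind
  · simp only [State.setReg_reg]
    grind [Function.update_apply]

/-- Arithmetic expressions over natural number variables, with access to one array. -/
inductive Expr : Type
  | var (x : ℕ) : Expr
  | const (c : ℕ) : Expr
  | add (a b : Expr) : Expr
  | sub (a b : Expr) : Expr
  | mul (a b : Expr) : Expr
  /-- `1` if the cell of the array with the index `a` holds `2`, and `0` otherwise -/
  | bit (a : Expr) : Expr
  /-- the sum of the values of `e`, where `x` runs through the numbers below `b` -/
  | sum (x : ℕ) (b e : Expr) : Expr

/-- A program that evaluates the expression into the register `t`. Each variable is the register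
with the same number, so these numbers have to be less than `t`. -/
def compile : Expr → ℕ → Prog
  | .var x, t => copy t x
  | .const c, t => .const t c
  | .add a b, t => .seq (compile a t) (.seq (compile b (t + 1)) (.add t t (t + 1)))
  | .sub a b, t => .seq (compile a t) (.seq (compile b (t + 1)) (.sub t t (t + 1)))
  | .mul a b, t => .seq (compile a t) (.seq (compile b (t + 1)) (multiply t))
  | .bit a, t => .seq (compile a t) (testBit t)
  | .sum x b e, t => .seq (compile b t) (sumOver x t (compile e (t + 3)))

namespace Expr

/-- The value of an expression, for the array `A` and the values `s` of the variables. -/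
def eval (A : ℕ → ℕ) : Expr → (ℕ → ℕ) → ℕ
  | var x, s => s x
  | const c, _ => c
  | add a b, s => eval A a s + eval A b s
  | sub a b, s => eval A a s - eval A b s
  | mul a b, s => eval A a s * eval A b s
  | bit a, s => if A (eval A a s) = 2 then 1 else 0
  | sum x b e, s => ∑ i ∈ Finset.range (eval A b s), eval A e (Function.update s x i)

/-- A bound for the number of steps that the compiled expression takes. -/
def cost (A : ℕ → ℕ) : Expr → (ℕ → ℕ) → ℕ
  | var _, _ => 2
  | const _, _ => 1
  | add a b, s => cost A a s + cost A b s + 1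
  | sub a b, s => cost A a s + cost A b s + 1
  | mul a b, s => cost A a s + cost A b s + (eval A a s * 3 + 5)
  | bit a, s => cost A a s + 7
  | sum x b e, s =>
    cost A b s + (∑ i ∈ Finset.range (eval A b s), (cost A e (Function.update s x i) + 5) + 9)

/-- All variables of an expression, free or bound, are less than `n`. -/
def Below (n : ℕ) : Expr → Bool
  | var x => x < n
  | const _ => true
  | add a b => Below n a && Below n b
  | sub a b => Below n a && Below n b
  | mul a b => Below n a && Below n b
  | bit a => Below n a
  | sum x b e => x < n && Below n b && Below n e

variable {n : ℕ} {e : Expr}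

theorem Below.mono {m : ℕ} (h : e.Below n) (hnm : n ≤ m) : e.Below m := by
  induction e <;> simp_all [Below] <;> omega

theorem eval_congr (A : ℕ → ℕ) (he : e.Below n) {s s' : ℕ → ℕ} (h : ∀ r < n, s r = s' r) :
    e.eval A s = e.eval A s' := by
  induction e generalizing s s' with
  | sum x b e ihb ihe =>
    simp only [Below, Bool.and_eq_true] at he
    rw [eval, eval, ihb he.1.2 h]
    refine Finset.sum_congr rfl fun i _ => ihe he.2 fun r hr => ?_
    simp only [Function.update_apply, h r hr]
  | _ => grind [Below, eval]

theorem cost_congr (A : ℕ → ℕ) (he : e.Below n) {s s' : ℕ → ℕ} (h : ∀ r < n, s r = s' r) :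
    e.cost A s = e.cost A s' := by
  induction e generalizing s s' with
  | sum x b e ihb ihe =>
    simp only [Below, Bool.and_eq_true] at he
    have hupdate (i : ℕ) : e.cost A (Function.update s x i) = e.cost A (Function.update s' x i) :=
      ihe he.2 fun r hr => by simp only [Function.update_apply, h r hr]
    simp only [cost, ihb he.1.2 h, eval_congr A he.1.2 h, hupdate]
  | mul a b iha ihb =>
    simp only [Below, Bool.and_eq_true] at he
    simp only [cost, iha he.1 h, ihb he.2 h, eval_congr A he.1 h]
  | _ => grind [Below, cost]

end Expr

theorem State.EqBelow.evaluates {s s' : State} {t : ℕ} (h : s.EqBelow t s') {e : Expr}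
    (he : e.Below t) {p : Prog} {u : ℕ}
    (hp : Evaluates p u s' (e.eval (s'.arr 1) s'.reg) (e.cost (s'.arr 1) s'.reg)) :
    Evaluates p u s' (e.eval (s.arr 1) s.reg) (e.cost (s.arr 1) s.reg) := by
  rwa [h.1, e.eval_congr _ he h.2, e.cost_congr _ he h.2] at hp

theorem evaluates_compile {e : Expr} {t u : ℕ} (he : e.Below t) (htu : t ≤ u) (s : State) :
    Evaluates (compile e u) u s (e.eval (s.arr 1) s.reg) (e.cost (s.arr 1) s.reg) := by
  induction e generalizing t u s with
  | var x => exact evaluates_copy s u ((of_decide_eq_true he).trans_le htu)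
  | const c => exact evaluates_const s u c
  | add a b iha ihb =>
    rw [Expr.Below, Bool.and_eq_true] at he
    refine (iha he.1 htu s).operands (fun s' heq =>
      (heq.mono htu).evaluates he.2 (ihb he.2 (by omega) s')) fun s' ha hb => ?_
    simpa only [Expr.eval, ha, hb] using evaluates_add s' u u (u + 1)
  | sub a b iha ihb =>
    rw [Expr.Below, Bool.and_eq_true] at he
    refine (iha he.1 htu s).operands (fun s' heq =>
      (heq.mono htu).evaluates he.2 (ihb he.2 (by omega) s')) fun s' ha hb => ?_
    simpa only [Expr.eval, ha, hb] using evaluates_sub s' u u (u + 1)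
  | mul a b iha ihb =>
    rw [Expr.Below, Bool.and_eq_true] at he
    refine (iha he.1 htu s).operands (fun s' heq =>
      (heq.mono htu).evaluates he.2 (ihb he.2 (by omega) s')) fun s' ha hb => ?_
    simpa only [Expr.eval, ha, hb] using evaluates_multiply s' u
  | bit a ih =>
    refine (ih he htu s).seq fun s' heq ha => ?_
    simpa only [Expr.eval, heq.1, ha] using evaluates_testBit s' u
  | sum x b e ihb ihe =>
    simp only [Expr.Below, Bool.and_eq_true, decide_eq_true_eq] at he
    obtain ⟨⟨hx, hb⟩, he⟩ := he
    refine (ihb hb htu s).seq fun s' heq hN => ?_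
    rw [Expr.eval, ← hN]
    refine evaluates_sumOver (hx.trans_le htu) _ _ fun i s₁ heq₁ => ?_
    have heq' : (s.setReg x i).EqBelow t s₁ := by
      refine ⟨heq₁.1.trans heq.1, fun r hr => (heq₁.2 r (by omega)).trans ?_⟩
      simp only [State.setReg_reg, Function.update_apply, heq.2 r (hr.trans_le htu)]
    exact heq'.evaluates he (ihe he (by omega) s₁)

/-! ## Polynomial bounds for the cost of expressions -/

/-- A function with a polynomial bound. The base `B + 2` is at least two, so that every constant is
bounded by a power of it. -/
def PolyBounded (f : ℕ → ℕ) : Prop := ∃ d, ∀ B, f B ≤ (B + 2) ^ d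

namespace PolyBounded

variable {f g : ℕ → ℕ}

theorem const (c : ℕ) : PolyBounded fun _ => c :=
  ⟨c, fun B => (Nat.lt_pow_self (by omega)).le⟩

theorem id : PolyBounded fun B => B := ⟨1, fun B => by simp⟩

theorem mul (hf : PolyBounded f) (hg : PolyBounded g) : PolyBounded fun B => f B * g B := by
  obtain ⟨d, hd⟩ := hf
  obtain ⟨e, he⟩ := hg
  exact ⟨d + e, fun B => by rw [pow_add]; exact Nat.mul_le_mul (hd B) (he B)⟩

theorem add (hf : PolyBounded f) (hg : PolyBounded g) : PolyBounded fun B => f B + g B := by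
  obtain ⟨d, hd⟩ := hf
  obtain ⟨e, he⟩ := hg
  refine ⟨max d e + 1, fun B => ?_⟩
  calc f B + g B ≤ (B + 2) ^ max d e + (B + 2) ^ max d e :=
        add_le_add ((hd B).trans (Nat.pow_le_pow_right (by omega) (le_max_left d e)))
          ((he B).trans (Nat.pow_le_pow_right (by omega) (le_max_right d e)))
    _ = (B + 2) ^ max d e * 2 := (mul_two _).symm
    _ ≤ (B + 2) ^ (max d e + 1) := by
        rw [pow_succ]
        exact Nat.mul_le_mul_left _ (by omega)

theorem comp (hf : PolyBounded f) (hg : PolyBounded g) : PolyBounded fun B => f (g B) := by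
  obtain ⟨d, hd⟩ := hf
  obtain ⟨e, he⟩ := hg.add (const 2)
  exact ⟨e * d, fun B => (hd _).trans (by rw [pow_mul]; exact Nat.pow_le_pow_left (he B) d)⟩

end PolyBounded

namespace Expr

/-- A bound for the values of an expression whose variables have values at most `B`. -/
def valueBound : Expr → ℕ → ℕ
  | var _, B => B
  | const c, _ => c
  | add a b, B => valueBound a B + valueBound b B
  | sub a _, B => valueBound a B
  | mul a b, B => valueBound a B * valueBound b B
  | bit _, _ => 1
  | sum _ b e, B => valueBound b B * valueBound e (B + valueBound b B)

/-- A bound for the cost of an expression whose variables have values at most `B`. -/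
def costBound : Expr → ℕ → ℕ
  | var _, _ => 2
  | const _, _ => 1
  | add a b, B => costBound a B + costBound b B + 1
  | sub a b, B => costBound a B + costBound b B + 1
  | mul a b, B => costBound a B + costBound b B + (valueBound a B * 3 + 5)
  | bit a, B => costBound a B + 7
  | sum _ b e, B =>
    costBound b B + (valueBound b B * (costBound e (B + valueBound b B) + 5) + 9)

theorem polyBounded_valueBound (e : Expr) : PolyBounded e.valueBound := by
  induction e with
  | var => exact .id
  | const c => exact .const c
  | add _ _ iha ihb => exact iha.add ihb
  | sub _ _ iha _ => exact iha
  | mul _ _ iha ihb => exact iha.mul ihb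
  | bit => exact .const 1
  | sum _ b e ihb ihe => exact ihb.mul (ihe.comp (.add .id ihb))

theorem polyBounded_costBound (e : Expr) : PolyBounded e.costBound := by
  induction e with
  | var => exact .const 2
  | const => exact .const 1
  | add _ _ iha ihb => exact (iha.add ihb).add (.const 1)
  | sub _ _ iha ihb => exact (iha.add ihb).add (.const 1)
  | mul a b iha ihb =>
    exact (iha.add ihb).add ((a.polyBounded_valueBound.mul (.const 3)).add (.const 5))
  | bit _ ih => exact ih.add (.const 7)
  | sum _ b e ihb ihe =>
    have hb := b.polyBounded_valueBound
    exact ihb.add ((hb.mul ((ihe.comp (.add .id hb)).add (.const 5))).add (.const 9))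

theorem update_le_add {s : ℕ → ℕ} {n B N i : ℕ} (hs : ∀ r < n, s r ≤ B) (hi : i ≤ N) (x : ℕ) :
    ∀ r < n, Function.update s x i r ≤ B + N := fun r hr => by
  have := hs r hr
  rw [Function.update_apply]
  split_ifs <;> omega

variable (A : ℕ → ℕ) {n : ℕ} {e : Expr} {s : ℕ → ℕ} {B : ℕ}

theorem eval_le_valueBound (he : e.Below n) (hs : ∀ r < n, s r ≤ B) :
    e.eval A s ≤ e.valueBound B := by
  induction e generalizing s B with
  | var x => exact hs x (of_decide_eq_true he)
  | const => exact le_rfl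
  | add a b iha ihb =>
    rw [Below, Bool.and_eq_true] at he
    exact add_le_add (iha he.1 hs) (ihb he.2 hs)
  | sub _ _ iha _ =>
    rw [Below, Bool.and_eq_true] at he
    exact (Nat.sub_le _ _).trans (iha he.1 hs)
  | mul a b iha ihb =>
    rw [Below, Bool.and_eq_true] at he
    exact Nat.mul_le_mul (iha he.1 hs) (ihb he.2 hs)
  | bit => rw [eval, valueBound]; split_ifs <;> omega
  | sum x b e ihb ihe =>
    simp only [Below, Bool.and_eq_true] at he
    have hb := ihb he.1.2 hs
    calc ∑ i ∈ Finset.range (b.eval A s), e.eval A (Function.update s x i)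
        ≤ ∑ _i ∈ Finset.range (b.eval A s), e.valueBound (B + b.valueBound B) :=
          Finset.sum_le_sum fun i hi => ihe he.2
            (update_le_add hs ((Finset.mem_range.1 hi).le.trans hb) x)
      _ = b.eval A s * e.valueBound (B + b.valueBound B) := by simp
      _ ≤ b.valueBound B * e.valueBound (B + b.valueBound B) := Nat.mul_le_mul_right _ hb

theorem cost_le_costBound (he : e.Below n) (hs : ∀ r < n, s r ≤ B) :
    e.cost A s ≤ e.costBound B := by
  induction e generalizing s B with
  | var x => exact le_rfl
  | const c => exact le_rfl
  | add a b iha ihb =>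
    rw [Below, Bool.and_eq_true] at he
    exact Nat.succ_le_succ (add_le_add (iha he.1 hs) (ihb he.2 hs))
  | sub a b iha ihb =>
    rw [Below, Bool.and_eq_true] at he
    exact Nat.succ_le_succ (add_le_add (iha he.1 hs) (ihb he.2 hs))
  | mul a b iha ihb =>
    rw [Below, Bool.and_eq_true] at he
    have ha := eval_le_valueBound A he.1 hs
    exact add_le_add (add_le_add (iha he.1 hs) (ihb he.2 hs)) (by omega)
  | bit a ih => exact Nat.add_le_add_right (ih he hs) 7
  | sum x b e ihb ihe =>
    simp only [Below, Bool.and_eq_true] at he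
    have hb := eval_le_valueBound A he.1.2 hs
    refine add_le_add (ihb he.1.2 hs) (Nat.add_le_add_right ?_ 9)
    calc ∑ i ∈ Finset.range (b.eval A s), (e.cost A (Function.update s x i) + 5)
        ≤ ∑ _i ∈ Finset.range (b.eval A s), (e.costBound (B + b.valueBound B) + 5) :=
          Finset.sum_le_sum fun i hi => Nat.add_le_add_right (ihe he.2
            (update_le_add hs ((Finset.mem_range.1 hi).le.trans hb) x)) 5
      _ = b.eval A s * (e.costBound (B + b.valueBound B) + 5) := by simp
      _ ≤ b.valueBound B * (e.costBound (B + b.valueBound B) + 5) := Nat.mul_le_mul_right _ hb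

end Expr

/-! ## Programs that compute an output string from expressions -/

@[simp]
theorem State.setArr_reg (s : State) (A i v : ℕ) : (s.setArr A i v).reg = s.reg := rfl

@[simp]
theorem State.setArr_arr (s : State) (A i v : ℕ) :
    (s.setArr A i v).arr = Function.update s.arr A (Function.update (s.arr A) i v) := rfl

theorem symbol_getElem?_eq_zero_iff {y : List Bool} {i : ℕ} : symbol y[i]? = 0 ↔ y.length ≤ i := by
  rw [← List.getElem?_eq_none_iff]
  rcases y[i]? with - | (- | -) <;> simp [symbol]

/-- A program that sets the registers `1, …, n` to `0`. -/
def clear : ℕ → Prog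
  | 0 => .skip
  | n + 1 => .seq (clear n) (.const (n + 1) 0)

/-- A program that copies the string in array `0` to array `1` and puts its length into register
`1`, which has to be `0` in the beginning; it uses the registers `t` and `t + 1`. -/
def readString (t : ℕ) : Prog :=
  .seq (.const (t + 1) 1) (.seq (.load t 0 1)
    (.loop t (.seq (.store 1 1 t) (.seq (.add 1 1 (t + 1)) (.load t 0 1)))))

/-- A program that writes the truth value of the formula `bit` into the cell of array `0` whose
index is the variable `2`, increments this variable, and decrements `reg (V + 1)`. -/
def writeBit (V : ℕ) (bit : Expr) : Prog :=
  .seq (compile bit (V + 2)) (.seq (.cond (V + 2) (.const (V + 2) 2) (.const (V + 2) 1))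
    (.seq (.store 0 2 (V + 2)) (.seq (.const (V + 2) 1) (.seq (.add 2 2 (V + 2))
      (.sub (V + 1) (V + 1) (V + 2))))))

/-- A program that writes an output: the string of the length `len` whose bits are the truth values
of the formula `bit` for the values of the variable `2` below `len`, and the parameter `par`. The
variables of the expressions are the registers before `V`. -/
def writeOutput (V : ℕ) (par len bit : Expr) : Prog :=
  .seq (compile par V) (.seq (compile len (V + 1)) (.seq (.loop (V + 1) (writeBit V bit))
    (.seq (.const (V + 1) 0) (.seq (.store 0 2 (V + 1)) (copy 0 V)))))

/-- A program that replaces an instance by the output that is described by the expressions, where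
the variable `0` is the given parameter and the variable `1` is the length of the given string. -/
def rewrite (V : ℕ) (par len bit : Expr) : Prog :=
  .seq (clear V) (.seq (readString V) (writeOutput V par len bit))

/-- The values of the variables for the parameter `k`, the length `L`, and the position `i`. -/
def inputEnv (k L i : ℕ) : ℕ → ℕ
  | 0 => k
  | 1 => L
  | 2 => i
  | _ => 0

theorem update_inputEnv (k L i : ℕ) : Function.update (inputEnv k L 0) 2 i = inputEnv k L i := by
  funext r
  rcases r with - | - | - | r <;> rfl

theorem inputEnv_zero_le (k L r : ℕ) : inputEnv k L 0 r ≤ k + L := by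
  rcases r with - | - | - | r <;> simp only [inputEnv] <;> omega

theorem exec_clear (n : ℕ) (s : State) : ∃ s', Exec (clear n) s (n + 1) s' ∧ s'.arr = s.arr ∧
    s'.reg 0 = s.reg 0 ∧ ∀ r, 0 < r → r ≤ n → s'.reg r = 0 := by
  induction n with
  | zero => exact ⟨s, .skip s, rfl, rfl, fun r h₁ h₂ => by omega⟩
  | succ n ih =>
    obtain ⟨s', hexec, harr, hzero, hclear⟩ := ih
    refine ⟨_, .seq hexec (.const _ _ _), harr, by simp [hzero], fun r h₁ h₂ => ?_⟩
    simp only [State.setReg_reg]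
    grind [Function.update_apply]

theorem exec_readString {t : ℕ} (ht : 1 < t) {s : State} {y : List Bool} {k : ℕ}
    (hs : IsOutput s y k) (hzero : s.reg 1 = 0) :
    ∃ n s', Exec (readString t) s n s' ∧ n ≤ y.length * 4 + 3 ∧
      (∀ i < y.length, s'.arr 1 i = symbol y[i]?) ∧ s'.reg 1 = y.length ∧
      ∀ r < t, r ≠ 1 → s'.reg r = s.reg r := by
  obtain ⟨n, s', hexec, hn, -, hcopy, -, -, hlength, hreg⟩ := Exec.loop_count (r := t)
    (p := .seq (.store 1 1 t) (.seq (.add 1 1 (t + 1)) (.load t 0 1))) (N := y.length)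
    (c := fun _ => 3)
    (I := fun i s' => s'.arr 0 = s.arr 0 ∧ (∀ j < i, s'.arr 1 j = symbol y[j]?) ∧
      s'.reg t = symbol y[i]? ∧ s'.reg (t + 1) = 1 ∧ s'.reg 1 = i ∧
      ∀ r < t, r ≠ 1 → s'.reg r = s.reg r)
    (s := (s.setReg (t + 1) 1).setReg t (s.arr 0 0))
    (by
      rintro i hi s' ⟨harr, hcopy, hsymbol, hone, hindex, hreg⟩
      refine ⟨?_, _, _, .seq (.store _ _ _ _) (.seq (.add _ _ _ _) (.load _ _ _ _)), le_rfl, ?_⟩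
      · rw [hsymbol, Ne, symbol_getElem?_eq_zero_iff]
        omega
      · have hnext := hs.2 (i + 1) hi
        simp only [State.setReg_reg, State.setReg_arr, State.setArr_reg, State.setArr_arr,
          Function.update_self, Function.update_of_ne zero_ne_one]
        grind [Function.update_apply])
    (fun s' h => by rw [h.2.2.1, symbol_getElem?_eq_zero_iff])
    (by
      have hfirst := hs.2 0 (Nat.zero_le _)
      simp only [State.setReg_reg, State.setReg_arr]
      grind [Function.update_apply])
  have hload := Exec.load (s.setReg (t + 1) 1) t 0 1
  rw [State.setReg_reg, Function.update_of_ne (by omega), hzero, State.setReg_arr] at hload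
  refine ⟨_, s', .seq (.const _ _ _) (.seq hload hexec), ?_, hcopy, hlength, hreg⟩
  simp only [Nat.reduceAdd, Finset.sum_const, Finset.card_range, smul_eq_mul] at hn
  omega

section WriteOutput

variable {V : ℕ} {par len bit : Expr}

theorem exec_writeBit (hV : 2 < V) (hbit : bit.Below V) (s : State) :
    ∃ n s', Exec (writeBit V bit) s n s' ∧ n ≤ bit.cost (s.arr 1) s.reg + 6 ∧
      s'.arr 1 = s.arr 1 ∧ s'.arr 0 = Function.update (s.arr 0) (s.reg 2)
        (if bit.eval (s.arr 1) s.reg = 0 then 1 else 2) ∧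
      s'.reg (V + 1) = s.reg (V + 1) - 1 ∧
      ∀ r ≤ V, s'.reg r = Function.update s.reg 2 (s.reg 2 + 1) r := by
  obtain ⟨n, s₁, hexec, hn, ⟨harr, hreg⟩, hvalue⟩ :=
    evaluates_compile hbit (Nat.le_add_right V 2) s
  have hcond : Exec (.cond (V + 2) (.const (V + 2) 2) (.const (V + 2) 1)) s₁ 2
      (s₁.setReg (V + 2) (if bit.eval (s.arr 1) s.reg = 0 then 1 else 2)) := by
    split_ifs with h
    · exact .condFalse (by rw [hvalue, h]) (.const _ _ _)
    · exact .condTrue (by rwa [hvalue]) (.const _ _ _)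
  refine ⟨_, _, .seq hexec (.seq hcond (.seq (.store _ _ _ _) (.seq (.const _ _ _)
    (.seq (.add _ _ _ _) (.sub _ _ _ _))))), by omega, ?_⟩
  simp only [State.setReg_reg, State.setReg_arr, State.setArr_reg, State.setArr_arr, harr,
    Function.update_self, Function.update_of_ne one_ne_zero]
  grind [Function.update_apply]

theorem exec_loop_writeBit (hV : 2 < V) (hbit : bit.Below V) {s : State} (hzero : s.reg 2 = 0)
    {C : ℕ} (hC : ∀ i < s.reg (V + 1), bit.cost (s.arr 1) (Function.update s.reg 2 i) ≤ C) :
    ∃ n s', Exec (.loop (V + 1) (writeBit V bit)) s n s' ∧ n ≤ s.reg (V + 1) * (C + 7) + 1 ∧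
      (∀ r ≤ V, s'.reg r = Function.update s.reg 2 (s.reg (V + 1)) r) ∧
      ∀ j < s.reg (V + 1), s'.arr 0 j =
        if bit.eval (s.arr 1) (Function.update s.reg 2 j) = 0 then 1 else 2 := by
  obtain ⟨n, s', hexec, hn, -, -, hreg, hwritten⟩ := Exec.loop_count (r := V + 1)
    (p := writeBit V bit) (N := s.reg (V + 1)) (c := fun _ => C + 6)
    (I := fun i s' => s'.arr 1 = s.arr 1 ∧ s'.reg (V + 1) = s.reg (V + 1) - i ∧
      (∀ r ≤ V, s'.reg r = Function.update s.reg 2 i r) ∧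
      ∀ j < i, s'.arr 0 j =
        if bit.eval (s.arr 1) (Function.update s.reg 2 j) = 0 then 1 else 2)
    (s := s)
    (by
      rintro i hi s' ⟨harr, hcount, hreg, hwritten⟩
      obtain ⟨n, s'', hexec, hn, harr', hout, hcount', hreg'⟩ := exec_writeBit hV hbit s'
      have hreg_lt (r : ℕ) (hr : r < V) := hreg r hr.le
      rw [harr, bit.cost_congr _ hbit hreg_lt] at hn
      rw [harr, bit.eval_congr _ hbit hreg_lt] at hout
      have hcost := hC i hi
      have hindex : s'.reg 2 = i := by rw [hreg 2 hV.le, Function.update_self]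
      rw [hindex] at hout hreg'
      refine ⟨by omega, n, s'', hexec, by omega, harr'.trans harr, by omega, fun r hr => ?_,
        fun j hj => ?_⟩
      · rw [hreg' r hr, Function.update_apply, hreg r hr, Function.update_apply,
          Function.update_apply]
        split_ifs <;> rfl
      · rw [hout, Function.update_apply]
        rcases eq_or_ne j i with rfl | hji
        · rw [if_pos rfl]
        · rw [if_neg hji, hwritten j (by omega)])
    (fun s' h => by omega)
    ⟨rfl, rfl, fun r _ => by rw [← hzero, Function.update_eq_self], by simp⟩
  refine ⟨n, s', hexec, ?_, hreg, hwritten⟩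
  simpa using hn

theorem exec_writeOutput (hV : 2 < V) (hpar : par.Below V) (hlen : len.Below V)
    (hbit : bit.Below V) {s : State} (hzero : s.reg 2 = 0) {C : ℕ}
    (hC : ∀ i < len.eval (s.arr 1) s.reg,
      bit.cost (s.arr 1) (Function.update s.reg 2 i) ≤ C) :
    ∃ n s', Exec (writeOutput V par len bit) s n s' ∧
      n ≤ par.cost (s.arr 1) s.reg + len.cost (s.arr 1) s.reg +
        len.eval (s.arr 1) s.reg * (C + 7) + 5 ∧
      IsOutput s' ((List.range (len.eval (s.arr 1) s.reg)).map fun i =>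
        decide (bit.eval (s.arr 1) (Function.update s.reg 2 i) ≠ 0))
        (par.eval (s.arr 1) s.reg) := by
  obtain ⟨n₁, s₁, hexec₁, hn₁, heq₁, hvalue₁⟩ := evaluates_compile hpar le_rfl s
  obtain ⟨n₂, s₂, hexec₂, hn₂, heq₂, hvalue₂⟩ :=
    heq₁.evaluates hlen (evaluates_compile hlen V.le_succ s₁)
  have heq : s.EqBelow V s₂ := heq₁.trans (heq₂.mono V.le_succ)
  have henv (i r : ℕ) (hr : r < V) :
      Function.update s₂.reg 2 i r = Function.update s.reg 2 i r := by
    simp only [Function.update_apply, heq.2 r hr]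
  obtain ⟨n₃, s₃, hexec₃, hn₃, hreg, hwritten⟩ :=
    exec_loop_writeBit (s := s₂) hV hbit ((heq.2 2 hV).trans hzero) (C := C) fun i hi => by
      rw [heq.1, bit.cost_congr _ hbit (henv i)]
      exact hC i (hvalue₂ ▸ hi)
  rw [hvalue₂] at hn₃ hreg hwritten
  have hpos : s₃.reg 2 = len.eval (s.arr 1) s.reg := by simp [hreg 2 hV.le]
  have hpar₃ : s₃.reg V = par.eval (s.arr 1) s.reg := by
    rw [hreg V le_rfl, Function.update_of_ne hV.ne', heq₂.2 V V.lt_succ_self, hvalue₁]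
  refine ⟨_, _, .seq hexec₁ (.seq hexec₂ (.seq hexec₃ (.seq (.const _ _ _)
    (.seq (.store _ _ _ _) (.copy _ (by omega)))))), by omega, by simp [hpar₃], fun i hi => ?_⟩
  rw [List.length_map, List.length_range] at hi
  rcases hi.lt_or_eq with hi | rfl
  · have hbit_i := hwritten i hi
    rw [heq.1, bit.eval_congr _ hbit (henv i)] at hbit_i
    rcases eq_or_ne (bit.eval (s.arr 1) (Function.update s.reg 2 i)) 0 with hzero_i | hzero_i <;>
      simp [List.getElem?_range hi, hbit_i, hpos, hi.ne, show 2 ≠ V + 1 by omega, symbol, hzero_i]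
  · simp [hpos, show 2 ≠ V + 1 by omega, symbol]

end WriteOutput

/-- A bound for the running time of `rewrite`, in terms of the sum of the length and the
parameter. -/
def rewriteBound (V : ℕ) (par len bit : Expr) (B : ℕ) : ℕ :=
  B * 4 + V + 10 + par.costBound B + len.costBound B +
    len.valueBound B * (bit.costBound (B + len.valueBound B) + 7)

theorem polyBounded_rewriteBound (V : ℕ) (par len bit : Expr) :
    PolyBounded (rewriteBound V par len bit) :=
  (((((PolyBounded.id.mul (.const 4)).add (.const V)).add (.const 10)).add
    par.polyBounded_costBound).add len.polyBounded_costBound).add (len.polyBounded_valueBound.mul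
      ((bit.polyBounded_costBound.comp (.add .id len.polyBounded_valueBound)).add (.const 7)))

theorem exec_rewrite {V : ℕ} (hV : 2 < V) {par len bit : Expr} (hpar : par.Below V)
    (hlen : len.Below V) (hbit : bit.Below V) {s : State} {y : List Bool} {k : ℕ}
    (hs : IsOutput s y k) :
    ∃ n s' A, Exec (rewrite V par len bit) s n s' ∧
      n ≤ rewriteBound V par len bit (k + y.length) ∧ (∀ i < y.length, A i = symbol y[i]?) ∧
      IsOutput s' ((List.range (len.eval A (inputEnv k y.length 0))).map fun i =>
        decide (bit.eval A (inputEnv k y.length i) ≠ 0)) (par.eval A (inputEnv k y.length 0)) := by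
  obtain ⟨s₁, hexec₁, harr₁, hzero₁, hclear₁⟩ := exec_clear V s
  have hs₁ : IsOutput s₁ y k := ⟨hzero₁.trans hs.1, harr₁ ▸ hs.2⟩
  obtain ⟨n₂, s₂, hexec₂, hn₂, hcopy, hlength, hreg₂⟩ :=
    exec_readString (t := V) (by omega) hs₁ (hclear₁ 1 one_pos (by omega))
  have hs₂ (r : ℕ) (hr : r < V) : s₂.reg r = inputEnv k y.length 0 r := by
    rcases r with - | - | r
    · rw [hreg₂ 0 hr zero_ne_one, hs₁.1, inputEnv]
    · exact hlength
    · rw [hreg₂ _ hr (by omega), hclear₁ _ (by omega) hr.le]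
      rcases r with - | r <;> rfl
  have hle (r : ℕ) (hr : r < V) : s₂.reg r ≤ k + y.length :=
    (hs₂ r hr).trans_le (inputEnv_zero_le k y.length r)
  have hlen_le := Expr.eval_le_valueBound (s₂.arr 1) hlen hle
  obtain ⟨n₃, s₃, hexec₃, hn₃, hout⟩ := exec_writeOutput hV hpar hlen hbit (hs₂ 2 hV)
    fun i hi => Expr.cost_le_costBound _ hbit (Expr.update_le_add hle (hi.le.trans hlen_le) 2)
  refine ⟨_, s₃, s₂.arr 1, .seq hexec₁ (.seq hexec₂ hexec₃), ?_, hcopy, ?_⟩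
  · have hpar_cost := Expr.cost_le_costBound (s₂.arr 1) hpar hle
    have hlen_cost := Expr.cost_le_costBound (s₂.arr 1) hlen hle
    have hmul := Nat.mul_le_mul_right
      (bit.costBound (k + y.length + len.valueBound (k + y.length)) + 7) hlen_le
    rw [rewriteBound]
    omega
  · have hbit_eval (i : ℕ) : bit.eval (s₂.arr 1) (Function.update s₂.reg 2 i) =
        bit.eval (s₂.arr 1) (inputEnv k y.length i) := by
      refine bit.eval_congr _ hbit fun r hr => ?_
      rw [← update_inputEnv, Function.update_apply, Function.update_apply, hs₂ r hr]
    simpa only [len.eval_congr _ hlen hs₂, par.eval_congr _ hpar hs₂, hbit_eval] using hout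

theorem Exec.exists_finset {p : Prog} {s s' : State} {t : ℕ} (h : Exec p s t s') (A : ℕ) :
    ∃ F : Finset ℕ, F.card ≤ t ∧ ∀ i ∉ F, s'.arr A i = s.arr A i := by
  induction h with
  | store s B i r =>
    refine ⟨{s.reg i}, by simp, fun j hj => ?_⟩
    rw [Finset.mem_singleton] at hj
    by_cases hA : A = B
    · subst hA
      simp [State.setArr, hj]
    · simp [State.setArr, hA]
  | seq _ _ ih ih' | loopStep _ _ _ ih ih' =>
    obtain ⟨F, hF, h⟩ := ih
    obtain ⟨F', hF', h'⟩ := ih'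
    refine ⟨F ∪ F', (Finset.card_union_le _ _).trans (by omega), fun i hi => ?_⟩
    rw [Finset.notMem_union] at hi
    rw [h' i hi.2, h i hi.1]
  | condTrue _ _ ih | condFalse _ _ ih =>
    obtain ⟨F, hF, h⟩ := ih
    exact ⟨F, by omega, h⟩
  | _ => exact ⟨∅, by simp, fun i _ => rfl⟩

theorem Exec.length_output_le {p : Prog} {x y : List Bool} {k k' t : ℕ} {s : State}
    (h : Exec p (input x k) t s) (hs : IsOutput s y k') : y.length ≤ x.length + t := by
  obtain ⟨F, hF, hcell⟩ := h.exists_finset 0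
  have hsub : Finset.range y.length ⊆ Finset.range x.length ∪ F := by
    intro i hi
    by_contra hno
    rw [Finset.mem_union, not_or, Finset.mem_range, not_lt] at hno
    have hi := Finset.mem_range.1 hi
    have hblank : symbol y[i]? = 0 := by
      rw [← hs.2 i hi.le, hcell i hno.2]
      exact symbol_getElem?_eq_zero_iff.2 hno.1
    exact hi.not_ge (symbol_getElem?_eq_zero_iff.1 hblank)
  have hcard := (Finset.card_le_card hsub).trans (Finset.card_union_le _ _)
  simp only [Finset.card_range] at hcard
  omega

end RAM

/-! ## Bounded formulas as expressions -/

namespace RAM.Expr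

instance : Add Expr := ⟨add⟩

instance : Mul Expr := ⟨mul⟩

instance (n : ℕ) : OfNat Expr n := ⟨const n⟩

/-- An expression, read as a formula, is true if its value is not `0`. -/
def Holds (A : ℕ → ℕ) (e : Expr) (s : ℕ → ℕ) : Prop := e.eval A s ≠ 0

/-- The formula `a < b`. -/
def lt (a b : Expr) : Expr := sub b a

/-- Negation. -/
def not (a : Expr) : Expr := sub 1 a

/-- The formula `a = b`; its value is at most `1`. -/
def eq (a b : Expr) : Expr := not (lt a b + lt b a)

/-- Conjunction. -/
instance : Min Expr := ⟨mul⟩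

/-- Disjunction. -/
instance : Max Expr := ⟨add⟩

/-- The formula `∃ x < b, e`. -/
def ex (x : ℕ) (b e : Expr) : Expr := sum x b e

/-- The formula `∀ x < b, e`. -/
def all (x : ℕ) (b e : Expr) : Expr := not (ex x b (not e))

variable {A : ℕ → ℕ} {a b e : Expr} {x : ℕ} {s : ℕ → ℕ}

theorem eval_var : (var x).eval A s = s x := rfl

theorem eval_add : (a + b).eval A s = a.eval A s + b.eval A s := rfl

theorem eval_mul : (a * b).eval A s = a.eval A s * b.eval A s := rfl

theorem eval_ofNat {n : ℕ} : (ofNat(n) : Expr).eval A s = n := rfl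

theorem eval_eq : (eq a b).eval A s = if a.eval A s = b.eval A s then 1 else 0 := by
  simp only [eq, not, lt, eval]
  split_ifs <;> omega

theorem holds_lt : (lt a b).Holds A s ↔ a.eval A s < b.eval A s := by
  simp only [Holds, lt, eval]
  omega

theorem holds_eq : (eq a b).Holds A s ↔ a.eval A s = b.eval A s := by
  simp [Holds, eval_eq]

theorem holds_and : (a ⊓ b).Holds A s ↔ a.Holds A s ∧ b.Holds A s := mul_ne_zero_iff

theorem holds_or : (a ⊔ b).Holds A s ↔ a.Holds A s ∨ b.Holds A s := by
  simp only [Holds, max, eval]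
  omega

theorem holds_not : (not a).Holds A s ↔ ¬a.Holds A s := by
  simp only [Holds, not, eval]
  omega

theorem holds_bit : (bit a).Holds A s ↔ A (a.eval A s) = 2 := by
  simp [Holds, eval]

theorem holds_ex : (ex x b e).Holds A s ↔
    ∃ i < b.eval A s, e.Holds A (Function.update s x i) := by
  simp [Holds, ex, eval, Finset.sum_eq_zero_iff]

theorem holds_all : (all x b e).Holds A s ↔
    ∀ i < b.eval A s, e.Holds A (Function.update s x i) := by
  simp [all, holds_not, holds_ex]

end RAM.Expr

/-! ## The constructed digraph as a bounded formula -/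

namespace ParamComplexity

open RAM RAM.Expr

/-- The expression for `numVars`. As in all following expressions, the variable `1` is the length
of the string. -/
def numVarsExpr : Expr :=
  let m : Expr := var 20
  sum 20 (var 1 + 1) ((m * 2 * (m * 2)).eq (var 1) * m)

/-- The number of rows of the grid. As in all following expressions, the variable `0` is the
parameter. -/
def rowsExpr : Expr := var 0 + 2

/-- The expression for `domainSize`. -/
def domainSizeExpr : Expr := (numVarsExpr + 3) * (numVarsExpr + 3)

/-- The expression for the `gridSize` of the instance. -/
def gridSizeExpr : Expr :=
  rowsExpr * rowsExpr + rowsExpr * rowsExpr + rowsExpr * (domainSizeExpr * rowsExpr + 2) * 2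

/-- The expression for the number of vertices of the constructed Euler digraph. -/
def eulerSizeExpr : Expr :=
  gridSizeExpr + (gridSizeExpr * gridSizeExpr + (gridSizeExpr * gridSizeExpr + 1))

/-- The formula `FalsifiedBy a b w s`. -/
def falsifiedExpr (a b w s : Expr) : Expr :=
  s.eq 0 ⊓ (a.lt (w + 1) ⊓ (w + 1).lt b) ⊔ s.eq 1 ⊓ (w + 1).eq a

/-- The formula `IsClauseAt y p`, where array `1` holds `y`. -/
def clauseExpr (p : Expr) : Expr := p.lt (var 1) ⊓ bit p

/-- The formula `InstanceCompat y k i u j v` for the variables `i = 7`, `u = 10`, `j = 8`, and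
`v = 11`. -/
def compatExpr : Expr :=
  let n := numVarsExpr
  let i : Expr := var 7
  let u : Expr := var 10
  let j : Expr := var 8
  let v : Expr := var 11
  let a : Expr := var 12
  let b : Expr := var 13
  let c : Expr := var 14
  let d : Expr := var 15
  let w : Expr := var 16
  let s : Expr := var 17
  let w' : Expr := var 18
  let s' : Expr := var 19
  (n * 2 * (n * 2)).eq (var 1) ⊓
    ex 12 (n + 3) (ex 13 (n + 3) (ex 14 (n + 3) (ex 15 (n + 3)
      (u.eq (a * (n + 3) + b) ⊓ (v.eq (c * (n + 3) + d) ⊓ (a.lt b ⊓ (c.lt d ⊓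
        (((i.eq 0).not ⊔ a.eq 0) ⊓ (((j.eq (var 0 + 1)).not ⊔ c.eq (n + 1)) ⊓
        (((j.eq (i + 1)).not ⊔ b.eq c) ⊓
        all 16 n (all 17 2 (all 18 n (all 19 2
          ((clauseExpr ((w * 2 + s) * (n * 2) + (w' * 2 + s'))).not ⊔
            ((falsifiedExpr a b w s ⊔ falsifiedExpr c d w s) ⊓
              (falsifiedExpr a b w' s' ⊔ falsifiedExpr c d w' s')).not))))))))))))))

/-- The formula `GridArc` for the variables `p = 5` and `q = 6`. -/
def gridArcExpr : Expr :=
  let K := rowsExpr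
  let M := domainSizeExpr
  let root (i j : Expr) : Expr := i * K + j
  let mate (i j : Expr) : Expr := K * K + (i * K + j)
  let node (i t l : Expr) : Expr := K * K + K * K + ((i * (M * K + 2) + t) * 2 + l)
  let arc (a b : Expr) : Expr := (var 5).eq a ⊓ (var 6).eq b
  let i : Expr := var 7
  let j : Expr := var 8
  let t : Expr := var 9
  let l : Expr := var 10
  let u : Expr := var 10
  let v : Expr := var 11
  ex 7 K (arc (root i i) (node i 0 0) ⊔
    (arc (node i (M * K + 1) 1) (root i i) ⊔
    (ex 9 (M * K + 1) (ex 10 2 (arc (node i t l) (node i (t + 1) l))) ⊔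
    (ex 9 (M * K + 2) (arc (node i t 0) (node i t 1)) ⊔
    (ex 11 M (arc (node i (v * K) 0) (node i (v * K + K + 1) 1)) ⊔
    ex 8 K (i.lt j ⊓
        (ex 10 M (arc (root i j) (node i (u * K + j + 1) 0)) ⊔
        (ex 10 M (ex 11 M (compatExpr ⊓
          arc (node i (u * K + j + 1) 1) (node j (v * K + i + 1) 0))) ⊔
        ex 11 M (arc (node j (v * K + i + 1) 1) (root i j)))) ⊔
      j.lt i ⊓ (arc (root i j) (mate i j) ⊔ arc (mate i j) (root i j))))))))

/-- The formula `EulerArc` for the variables `p = 3` and `q = 4`. -/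
def eulerArcExpr : Expr :=
  let N := gridSizeExpr
  let u : Expr := var 5
  let v : Expr := var 6
  let toHub := N + (u * N + v)
  let fromHub := N + (N * N + (u * N + v))
  let hub := N + (N * N + N * N)
  let arc (a b : Expr) : Expr := (var 3).eq a ⊓ (var 4).eq b
  ex 5 N (arc u hub ⊔ (arc hub u ⊔
    ex 6 N (arc toHub hub ⊔ (arc hub fromHub ⊔
      (gridArcExpr ⊓ (arc u v ⊔ (arc v toHub ⊔ arc fromHub u)) ⊔
        gridArcExpr.not ⊓ (arc hub toHub ⊔ arc fromHub hub))))))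

/-- The formula that says that the adjacency matrix has a `1` at the position `2`. -/
def entryExpr : Expr :=
  ex 3 eulerSizeExpr (ex 4 eulerSizeExpr
    ((var 2).eq (var 3 * eulerSizeExpr + var 4) ⊓ eulerArcExpr))

theorem below_eulerSizeExpr : (eulerSizeExpr * eulerSizeExpr).Below 21 := by decide

theorem below_entryExpr : entryExpr.Below 21 := by decide

section Semantics

variable {A s : ℕ → ℕ}

theorem eval_numVarsExpr : numVarsExpr.eval A s = numVars (s 1) := by
  simp [numVarsExpr, eval, eval_eq, numVars]

theorem eval_rowsExpr : rowsExpr.eval A s = s 0 + 2 := rfl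

theorem eval_domainSizeExpr : domainSizeExpr.eval A s = domainSize (s 1) := by
  simp only [domainSizeExpr, eval_add, eval_mul, eval_ofNat, eval_numVarsExpr, domainSize]

theorem eval_gridSizeExpr :
    gridSizeExpr.eval A s = gridSize (s 0 + 2) (domainSize (s 1)) := by
  simp only [gridSizeExpr, eval_add, eval_mul, eval_ofNat, eval_domainSizeExpr, eval_rowsExpr,
    gridSize]

theorem eval_eulerSizeExpr :
    eulerSizeExpr.eval A s = eulerSize (gridSize (s 0 + 2) (domainSize (s 1))) := by
  simp only [eulerSizeExpr, eval_add, eval_mul, eval_ofNat, eval_gridSizeExpr]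

theorem holds_falsifiedExpr {a b w e : Expr} : (falsifiedExpr a b w e).Holds A s ↔
    FalsifiedBy (a.eval A s) (b.eval A s) (w.eval A s) (e.eval A s) := by
  simp only [falsifiedExpr, holds_or, holds_and, holds_eq, holds_lt, eval_add, eval_ofNat,
    FalsifiedBy]

variable {y : List Bool} (hA : ∀ i < y.length, A i = symbol y[i]?)

include hA

theorem holds_clauseExpr (hs : s 1 = y.length) {p : Expr} :
    (clauseExpr p).Holds A s ↔ IsClauseAt y (p.eval A s) := by
  simp only [clauseExpr, holds_and, holds_lt, holds_bit, eval_var, hs, IsClauseAt]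
  constructor
  · rintro ⟨hlt, hbit⟩
    rw [hA _ hlt] at hbit
    rcases h : y[p.eval A s]? with - | (- | -) <;> simp_all [symbol]
  · intro h
    obtain ⟨hlt, -⟩ := List.getElem?_eq_some_iff.1 h
    exact ⟨hlt, by rw [hA _ hlt, h, symbol]⟩

theorem holds_compatExpr (hs : s 1 = y.length) :
    compatExpr.Holds A s ↔ InstanceCompat y (s 0) (s 7) (s 10) (s 8) (s 11) := by
  have hclause {s : ℕ → ℕ} {p : Expr} (hs : s 1 = y.length) := holds_clauseExpr hA hs (p := p)
  simp [compatExpr, InstanceCompat, GapCompat, holds_and, holds_or, holds_not, holds_eq, holds_lt,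
    holds_ex, holds_all, eval_var, eval_add, eval_mul, eval_ofNat, eval_numVarsExpr,
    holds_falsifiedExpr, hclause, hs, imp_iff_not_or]

theorem holds_gridArcExpr (hs : s 1 = y.length) :
    gridArcExpr.Holds A s ↔
      GridArc (s 0 + 2) (domainSize y.length) (InstanceCompat y (s 0)) (s 5) (s 6) := by
  have hcompat {s : ℕ → ℕ} (hs : s 1 = y.length) := holds_compatExpr hA hs
  simp [gridArcExpr, GridArc, gridCode, holds_and, holds_or, holds_eq, holds_lt, holds_ex,
    eval_var, eval_add, eval_mul, eval_ofNat, eval_rowsExpr, eval_domainSizeExpr, hcompat, hs]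

theorem holds_eulerArcExpr (hs : s 1 = y.length) :
    eulerArcExpr.Holds A s ↔ EulerArc (gridSize (s 0 + 2) (domainSize y.length))
      (GridArc (s 0 + 2) (domainSize y.length) (InstanceCompat y (s 0))) (s 3) (s 4) := by
  have harc {s : ℕ → ℕ} (hs : s 1 = y.length) := holds_gridArcExpr hA hs
  simp [eulerArcExpr, EulerArc, holds_and, holds_or, holds_not, holds_eq, holds_ex, eval_var,
    eval_add, eval_mul, eval_gridSizeExpr, harc, hs]

theorem holds_entryExpr (hs : s 1 = y.length) :
    let N := eulerSize (gridSize (s 0 + 2) (domainSize y.length))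
    entryExpr.Holds A s ↔ ∃ u < N, ∃ v < N, s 2 = u * N + v ∧
      EulerArc (gridSize (s 0 + 2) (domainSize y.length))
        (GridArc (s 0 + 2) (domainSize y.length) (InstanceCompat y (s 0))) u v := by
  have harc {s : ℕ → ℕ} (hs : s 1 = y.length) := holds_eulerArcExpr hA hs
  simp [entryExpr, holds_and, holds_eq, holds_ex, eval_var, eval_add, eval_mul,
    eval_eulerSizeExpr, harc, hs]

end Semantics

/-! ## The reduction -/

open Digraph

theorem computable_add {f g : ℕ → ℕ} (hf : Computable f) (hg : Computable g) :
    Computable fun k => f k + g k :=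
  Primrec.nat_add.to_comp.comp hf hg

theorem computable_pow {f : ℕ → ℕ} (hf : Computable f) (d : ℕ) :
    Computable fun k => f k ^ d := by
  induction d with
  | zero => simpa only [pow_zero] using Computable.const 1
  | succ d ih =>
    simp only [pow_succ]
    exact Primrec.nat_mul.to_comp.comp ih hf

theorem add_pow_le_mul_pow {a b g n t X c d : ℕ} (hX : 1 ≤ X) (ht : t ≤ a * X ^ c)
    (hb : b ≤ g + X + t) (hn : n ≤ (b + 2) ^ d) :
    t + n ≤ (a + (g + a + 3) ^ d) * X ^ (c + (c + 1) * d) := by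
  have hmono {e e' : ℕ} (h : e ≤ e') : X ^ e ≤ X ^ e' := Nat.pow_le_pow_right hX h
  have hbase : b + 2 ≤ (g + a + 3) * X ^ (c + 1) := by
    have hone : 1 ≤ X ^ (c + 1) := Nat.one_le_pow _ _ hX
    have hself : X ≤ X ^ (c + 1) := Nat.le_self_pow c.succ_ne_zero X
    have ht' : t ≤ a * X ^ (c + 1) := ht.trans (Nat.mul_le_mul_left _ (hmono c.le_succ))
    nlinarith
  calc t + n ≤ a * X ^ c + ((g + a + 3) * X ^ (c + 1)) ^ d :=
        Nat.add_le_add ht (hn.trans (Nat.pow_le_pow_left hbase d))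
    _ = a * X ^ c + (g + a + 3) ^ d * X ^ ((c + 1) * d) := by rw [mul_pow, pow_mul]
    _ ≤ a * X ^ (c + (c + 1) * d) + (g + a + 3) ^ d * X ^ (c + (c + 1) * d) :=
        Nat.add_le_add (Nat.mul_le_mul_left _ (hmono (by omega)))
          (Nat.mul_le_mul_left _ (hmono (by omega)))
    _ = (a + (g + a + 3) ^ d) * X ^ (c + (c + 1) * d) := (Nat.add_mul ..).symm

/-- The map `T` is computed by a program that, started in any state that shows the output `(y, k)`,
halts after polynomially many steps and shows `T (y, k)`. In contrast to the initial states of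
`FPTComputable`, the other registers and arrays may hold anything, so the program can be run after
another one. -/
def PolyComputable (T : Instance → Instance) : Prop :=
  ∃ (q : Prog) (d : ℕ), ∀ (y : List Bool) (k : ℕ) (s : State), IsOutput s y k →
    ∃ n s', Exec q s n s' ∧ n ≤ (k + y.length + 2) ^ d ∧ IsOutput s' (T (y, k)).1 (T (y, k)).2

theorem FPTComputable.comp {R T : Instance → Instance} (hT : PolyComputable T)
    (hR : FPTComputable R) {g : ℕ → ℕ} (hg : Computable g)
    (hle : ∀ (x : List Bool) (k : ℕ), (R (x, k)).2 ≤ g k) : FPTComputable (T ∘ R) := by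
  obtain ⟨p, f, c, hf, hp⟩ := hR
  obtain ⟨q, d, hq⟩ := hT
  have hbound : Computable fun k => f k + (g k + f k + 3) ^ d :=
    computable_add hf (computable_pow (computable_add (computable_add hg hf) (.const 3)) d)
  refine ⟨.seq p q, _, c + (c + 1) * d, hbound, fun x k => ?_⟩
  obtain ⟨t, s, hexec, ht, hs⟩ := hp x k
  obtain ⟨n, s', hexec', hn, hs'⟩ := hq _ _ s hs
  refine ⟨t + n, s', hexec.seq hexec', ?_, hs'⟩
  have hlen := hexec.length_output_le hs
  have hparam := hle x k
  exact add_pow_le_mul_pow (b := (R (x, k)).2 + (R (x, k)).1.length) (by omega) ht (by omega) hn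

theorem IsFPTReduction.comp {R T : Instance → Instance} {L L' L'' : Problem}
    (hT : PolyComputable T) (hmem : ∀ w, w ∈ L' ↔ T w ∈ L'') {e : ℕ → ℕ} (he : Computable e)
    (hmono : Monotone e) (hparam : ∀ w, (T w).2 ≤ e w.2) (hR : IsFPTReduction R L L') :
    IsFPTReduction (T ∘ R) L L'' := by
  obtain ⟨g, hg, hle⟩ := hR.param_le
  exact ⟨fun w => (hR.mem_iff w).trans (hmem _), hR.computable.comp hT hg hle,
    e ∘ g, he.comp hg, fun x k => (hparam _).trans (hmono (hle x k))⟩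

/-- The reduction from Weighted 2-CNF-Satisfiability to disjoint cycles in Euler digraphs. -/
noncomputable def eulerInstance (w : Instance) : Instance :=
  ((finEuler (w.2 + 2) (domainSize w.1.length) (InstanceCompat w.1 w.2)).encode,
    (w.2 + 2) * (w.2 + 2) + 1)

theorem mem_weightedTwoCNFSat_iff_eulerInstance (w : Instance) :
    w ∈ weightedTwoCNFSat ↔ eulerInstance w ∈ vertexDisjointCycles := by
  rw [eulerInstance, encode_mem_vertexDisjointCycles_iff finEuler_loopless,
    hasDisjointCycles_finEuler_iff (by omega), ← mem_weightedTwoCNFSat_iff_hasDisjointCycles_grid]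

theorem eulerInstance_mem_eulerInstances (w : Instance) : eulerInstance w ∈ eulerInstances :=
  ⟨_, _, finEuler_loopless, finEuler_isEuler, rfl⟩

theorem holds_entryExpr_iff_adj {A : ℕ → ℕ} {y : List Bool} {k : ℕ}
    (hA : ∀ i < y.length, A i = symbol y[i]?)
    (u v : Fin (eulerSize (gridSize (k + 2) (domainSize y.length)))) :
    entryExpr.Holds A
        (inputEnv k y.length (u * eulerSize (gridSize (k + 2) (domainSize y.length)) + v)) ↔
      (finEuler (k + 2) (domainSize y.length) (InstanceCompat y k)).Adj u v := by
  rw [finEuler_adj]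
  refine (holds_entryExpr hA rfl).trans ⟨?_, fun harc => ⟨u, u.2, v, v.2, rfl, harc⟩⟩
  rintro ⟨u', -, v', hv', heq, harc⟩
  obtain ⟨hu, hv⟩ := mul_add_inj v.2 hv' heq
  rwa [hu, hv]

theorem polyComputable_eulerInstance : PolyComputable eulerInstance := by
  let par := rowsExpr * rowsExpr + 1
  let len := eulerSizeExpr * eulerSizeExpr
  obtain ⟨d, hd⟩ := polyBounded_rewriteBound 21 par len entryExpr
  refine ⟨rewrite 21 par len entryExpr, d, fun y k s hs => ?_⟩
  obtain ⟨n, s', A, hexec, hn, hA, hout⟩ := exec_rewrite (V := 21) (by omega)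
    (by decide : par.Below 21) below_eulerSizeExpr below_entryExpr hs
  refine ⟨n, s', hexec, hn.trans (hd _), ?_⟩
  let N := eulerSize (gridSize (k + 2) (domainSize y.length))
  have hlen : len.eval A (inputEnv k y.length 0) = N * N := by
    simp only [len, eval_mul, eval_eulerSizeExpr, inputEnv, N]
  rw [hlen] at hout
  suffices hentry : (List.range (N * N)).map
      (fun i => decide (entryExpr.eval A (inputEnv k y.length i) ≠ 0)) =
      (finEuler (k + 2) (domainSize y.length) (InstanceCompat y k)).encode by
    rwa [hentry] at hout
  refine eq_encodeMatrix (by rw [List.length_map, List.length_range]) _ fun u v => ?_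
  rw [List.getElem?_map, List.getElem?_range (mul_add_lt_mul u.2 v.2), Option.map_some]
  congr 2
  exact propext (holds_entryExpr_iff_adj hA u v)

theorem IsFPTReduction.eulerInstance_comp {R : Instance → Instance} {L : Problem}
    (hR : IsFPTReduction R L weightedTwoCNFSat) :
    IsFPTReduction (eulerInstance ∘ R) L vertexDisjointCycles := by
  have hparam : Computable fun k => (k + 2) ^ 2 + 1 :=
    computable_add (computable_pow (computable_add .id (.const 2)) 2) (.const 1)
  have hmono : Monotone fun k => (k + 2) ^ 2 + 1 := fun k k' h => by
    dsimp only
    gcongr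
  exact hR.comp polyComputable_eulerInstance mem_weightedTwoCNFSat_iff_eulerInstance hparam hmono
    fun w => (congrArg (· + 1) (sq (w.2 + 2))).ge

end ParamComplexity

theorem mainTheorem4 :
    ParamComplexity.IsW1HardOn Digraph.vertexDisjointCycles Digraph.eulerInstances := by
  rintro L ⟨R, hR⟩
  exact ⟨ParamComplexity.eulerInstance ∘ R, hR.eulerInstance_comp,
    fun w => ParamComplexity.eulerInstance_mem_eulerInstances (R w)⟩
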